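/- Consider a contingency table $n=(n_1,\dots,n_k)^T$ of counts observed under one of the following sampling plans: Poisson sampling ($c=0$; independent Poisson counts with mean vector $m=(m_1,\dots,m_k)^T$), or product multinomial sampling ($c\ge 1$; independent Poisson counts with mean vector $m$, conditioned on the totals of $c$ nonempty subtables that partition the cells being equal to prefixed integers $N_1,\dots,N_c$; multinomial sampling is $c=1$). Let $X_0$ be the $k\times c$ matrix whose columns are the indicator vectors of the subtables (no columns if $c=0$). A loglinear model with linear constraints (LMLC) $M$ is given by a known $k\times t$ design matrix $X$ of rank $t$, a $k\times r$ matrix $C$ with $r\le t-c$ such that $L=(X_0,C)$ has rank $c+r$, and a vector $d^*\in\mathbb{R}^r$ (which may vary along the asymptotics, as $m$ does). With $m(\theta)=\exp(X\theta)$ (componentwise), its parameter space is $$\Theta=\{\theta\in\mathbb{R}^t : L^Tm(\theta)=d\},\qquad d=\begin{pmatrix}X_0^Tn\\ d^*\end{pmatrix},$$ and $M$ is identified with the set of mean vectors $\{m(\theta):\theta\in\Theta\}$. Let $\Phi$ be the class of convex functions $\phi:[0,\infty)\to\mathbb{R}\cup\{\infty\}$, differentiable on $(0,\infty)$, with $\phi(1)=\phi'(1)=0$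 and $\phi''(1)>0$; for nonnegative vectors $a,b$ put $D_\phi(a,b)=\sum_{i=1}^k b_i\,\phi(a_i/b_i)$, with $0\,\phi(0/0)=0$ and $0\,\phi(p/0)=p\lim_{u\to\infty}\phi(u)/u$. The minimum $\phi$-divergence estimator in $M$ is $\hat\theta^{\phi}=\arg\min_{\theta\in\Theta}D_\phi(n,m(\theta))$ (any minimizer; arbitrary for tables for which no minimizer exists). Let $M_1,\dots,M_B$ be LMLC for the same sampling plan, with $X_b,C_b,L_b,t_b,r_b,\Theta_b$, such that $M_{b+1}$ is nested within $M_b$ for $b=1,\dots,B-1$: $\mathcal{C}(X_{b+1})\subseteq\mathcal{C}(X_b)$ and $\mathcal{C}(L_b)\subseteq\mathcal{C}(L_{b+1})$ (column spaces), $t_{b+1}\le t_b$ and $r_{b+1}\ge r_b$ with at least one inequality strict, and $M_{b+1}\subseteq M_b$ as sets of mean vectors. Let $b\in\{1,\dots,B-1\}$ and suppose that $H_{Null}(b)$ holds, i.e. that the true mean vector $m$ belongs to $M_{b+1}$. Let $N=\sum_i m_i\to\infty$ while the normalized vector $m^*=m/N$ remains fixed, and suppose that the matrix $X_{b+1}^T\,\mathrm{diag}(m^*)\,L_{b+1}$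 has full column rank $c+r_{b+1}$. Then, for all $\phi_1,\phi_2\in\Phi$, the statistic $$T^{\phi_1}(\hat\theta^{\phi_2}_{b+1}\mid\hat\theta^{\phi_2}_b)=\frac{2}{\phi_1''(1)}\,D_{\phi_1}\bigl(m(\hat\theta_b^{\phi_2}),m(\hat\theta_{b+1}^{\phi_2})\bigr)$$ converges in distribution to a chi-square law with $t_b-t_{b+1}-r_b+r_{b+1}$ degrees of freedom, and, for every $\phi\in\Phi$, so does $$S^{\phi}(\hat\theta^{\phi}_{b+1}\mid\hat\theta^{\phi}_b)=\frac{2}{\phi''(1)}\Bigl(D_{\phi}\bigl(n,m(\hat\theta^{\phi}_{b+1})\bigr)-D_{\phi}\bigl(n,m(\hat\theta^{\phi}_{b})\bigr)\Bigr).$$ -/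

import Mathlib

open MeasureTheory ProbabilityTheory Filter
open scoped Matrix

noncomputable section

namespace LoglinearLC

/-! ### Divergences -/

/-- The real-valued version of an extended-real function `φ` (it agrees with `φ` where `φ` is
finite). -/
def realVersion (φ : ℝ → EReal) : ℝ → ℝ := fun x => (φ x).toReal

/-- The second derivative `φ''(1)`. -/
def secondDerivOne (φ : ℝ → EReal) : ℝ := deriv (deriv (realVersion φ)) 1

/-- The class `Φ` of convex functions `φ : [0, ∞) → ℝ ∪ {∞}`, differentiable on `(0, ∞)`, with
`φ 1 = φ' 1 = 0` and `φ'' 1 > 0`. Only the values of `φ` on `[0, ∞)` are ever used; the value `∞`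
is possible only at `0`. -/
structure IsPhi (φ : ℝ → EReal) : Prop where
  zero_ne_bot : φ 0 ≠ ⊥
  finite_of_pos : ∀ x : ℝ, 0 < x → φ x ≠ ⊥ ∧ φ x ≠ ⊤
  convex : ∀ x y a b : ℝ, 0 ≤ x → 0 ≤ y → 0 ≤ a → 0 ≤ b → a + b = 1 →
    φ (a * x + b * y) ≤ (a : EReal) * φ x + (b : EReal) * φ y
  differentiableOn : DifferentiableOn ℝ (realVersion φ) (Set.Ioi 0)
  map_one : φ 1 = 0
  deriv_one : deriv (realVersion φ) 1 = 0
  secondDeriv_one_pos : 0 < secondDerivOne φ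

/-- The term `b φ(a / b)`, with the conventions `0 φ(0 / 0) = 0` and
`0 φ(p / 0) = p lim_{u → ∞} φ(u) / u` (for convex `φ` the limit exists, so that it is the upper
limit). -/
def divTerm (φ : ℝ → EReal) (a b : ℝ) : EReal :=
  if b = 0 then
    if a = 0 then 0 else (a : EReal) * limsup (fun u : ℝ => φ u / (u : EReal)) atTop
  else (b : EReal) * φ (a / b)

/-- The `φ`-divergence `D_φ(a, b) = ∑ i, b i φ(a i / b i)` between nonnegative vectors. -/
def phiDiv {k : ℕ} (φ : ℝ → EReal) (a b : Fin k → ℝ) : EReal :=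
  ∑ i, divTerm φ (a i) (b i)

/-! ### Sampling plans -/

/-- Sampling plan of a table with `k` cells: Poisson sampling (no prefixed total), or product
multinomial sampling, where the cells are partitioned into `c ≥ 1` nonempty subtables whose totals
are prefixed (`c = 1` is multinomial sampling). -/
inductive SamplingPlan (k : ℕ) where
  | poisson : SamplingPlan k
  | productMultinomial (c : ℕ) (hc : 1 ≤ c) (subtable : Fin k → Fin c)
      (hs : Function.Surjective subtable) : SamplingPlan k

/-- The number `c` of prefixed totals. -/
def SamplingPlan.c {k : ℕ} : SamplingPlan k → ℕ
  | .poisson => 0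
  | .productMultinomial c _ _ _ => c

/-- The `k × c` matrix `X₀`, whose columns are the indicators of the subtables. -/
def SamplingPlan.X0 {k : ℕ} : (S : SamplingPlan k) → Matrix (Fin k) (Fin S.c) ℝ
  | .poisson => 0
  | .productMultinomial c _ subtable _ =>
    Matrix.of fun (i : Fin k) (h : Fin c) => if subtable i = h then 1 else 0

/-- A table of counts, as a real vector. -/
def realCounts {k : ℕ} (n : Fin k → ℕ) : Fin k → ℝ := fun i => (n i : ℝ)

/-- The totals `X₀ᵀ v`. -/
def SamplingPlan.totals {k : ℕ} (S : SamplingPlan k) (v : Fin k → ℝ) : Fin S.c → ℝ :=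
  S.X0ᵀ *ᵥ v

/-- The law of the table: independent Poisson counts with mean vector `m`, given that the totals
take the prefixed values `N h`. For `c = 0` the conditioning event is everything, and this is the
product of Poisson laws; for `c ≥ 1` it is the product multinomial law with sample sizes `N h` and
cell probabilities proportional to `m` in each subtable. -/
def SamplingPlan.tableLaw {k : ℕ} (S : SamplingPlan k) (m : Fin k → ℝ) (N : Fin S.c → ℕ) :
    Measure (Fin k → ℕ) :=
  ProbabilityTheory.cond (Measure.pi fun i => poissonMeasure (m i).toNNReal)
    {n | S.totals (realCounts n) = fun h => (N h : ℝ)}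

/-! ### Loglinear models with linear constraints -/

/-- The data of a loglinear model with linear constraints: a full rank `k × t` design matrix `X`
and a `k × r` matrix `C` of linear constraints in addition to those of the sampling plan, such that
`L = (X₀, C)` has rank `c + r`, and `r ≤ t - c`. -/
structure LMLC {k : ℕ} (S : SamplingPlan k) where
  t : ℕ
  r : ℕ
  X : Matrix (Fin k) (Fin t) ℝ
  C : Matrix (Fin k) (Fin r) ℝ
  rank_X : X.rank = t
  rank_L : (Matrix.fromCols S.X0 C).rank = S.c + r
  card_le : S.c + r ≤ t

namespace LMLC

variable {k : ℕ} {S : SamplingPlan k}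

/-- The constraint matrix `L = (X₀, C)`. -/
def L (M : LMLC S) : Matrix (Fin k) (Fin S.c ⊕ Fin M.r) ℝ := Matrix.fromCols S.X0 M.C

/-- The mean vector `m(θ)`, given by `log m(θ) = X θ`. -/
def mean (M : LMLC S) (θ : Fin M.t → ℝ) : Fin k → ℝ := fun i => Real.exp ((M.X *ᵥ θ) i)

/-- The parameter space `Θ = {θ : Lᵀ m(θ) = d}` with `d = (s, d*)`, where `s` are the totals and
`d*` is the right-hand side of the additional constraints. -/
def paramSpace (M : LMLC S) (s : Fin S.c → ℝ) (dstar : Fin M.r → ℝ) : Set (Fin M.t → ℝ) :=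
  {θ | M.Lᵀ *ᵥ M.mean θ = Sum.elim s dstar}

/-- The set of mean vectors of the model. -/
def meanSet (M : LMLC S) (s : Fin S.c → ℝ) (dstar : Fin M.r → ℝ) : Set (Fin k → ℝ) :=
  M.mean '' M.paramSpace s dstar

/-- `est` is a minimum `φ`-divergence estimator: to every table `n` for which
`θ ↦ D_φ(n, m(θ))` has a minimizer over `Θ` (with `d = (X₀ᵀ n, d*)`), it assigns such a minimizer.
(For tables without a minimizer, for instance with too many empty cells, the value of the estimator
is not specified.) -/
def IsMinPhiDivEstimator (M : LMLC S) (φ : ℝ → EReal) (dstar : Fin M.r → ℝ)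
    (est : (Fin k → ℕ) → (Fin M.t → ℝ)) : Prop :=
  ∀ n : Fin k → ℕ,
    (∃ θ ∈ M.paramSpace (S.totals (realCounts n)) dstar,
      IsMinOn (fun θ => phiDiv φ (realCounts n) (M.mean θ))
        (M.paramSpace (S.totals (realCounts n)) dstar) θ) →
    est n ∈ M.paramSpace (S.totals (realCounts n)) dstar ∧
      IsMinOn (fun θ => phiDiv φ (realCounts n) (M.mean θ))
        (M.paramSpace (S.totals (realCounts n)) dstar) (est n)

/-- `M'` (with right-hand side `dstar'`) is nested within `M` (with right-hand side `dstar`): the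
column spaces satisfy `𝒞(X') ⊆ 𝒞(X)` and `𝒞(L) ⊆ 𝒞(L')`, with `t' ≤ t` and `r ≤ r'`, at least one
of the two being strict, and every mean vector of `M'` is one of `M`. -/
structure Nested (M' M : LMLC S) (s : Fin S.c → ℝ) (dstar' : Fin M'.r → ℝ)
    (dstar : Fin M.r → ℝ) : Prop where
  range_X : LinearMap.range M'.X.mulVecLin ≤ LinearMap.range M.X.mulVecLin
  range_L : LinearMap.range M.L.mulVecLin ≤ LinearMap.range M'.L.mulVecLin
  t_le : M'.t ≤ M.t
  r_le : M.r ≤ M'.r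
  strict : M'.t < M.t ∨ M.r < M'.r
  meanSet_subset : M'.meanSet s dstar' ⊆ M.meanSet s dstar

end LMLC

/-! ### Test statistics and the limit law -/

/-- The statistic `T = (2 / φ''(1)) D_φ(m, m')`, where `m` and `m'` are the fitted means in the
larger and in the smaller model (the divergence is finite, since these vectors are positive). -/
def statT {k : ℕ} (φ : ℝ → EReal) (m m' : Fin k → ℝ) : ℝ :=
  2 / secondDerivOne φ * (phiDiv φ m m').toReal

/-- The statistic `S = (2 / φ''(1)) (D_φ(n, m') - D_φ(n, m))`, where `m` and `m'` are the fitted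
means in the larger and in the smaller model. (The divergences are finite when no cell is empty, in
particular with probability tending to one.) -/
def statS {k : ℕ} (φ : ℝ → EReal) (n m m' : Fin k → ℝ) : ℝ :=
  2 / secondDerivOne φ * ((phiDiv φ n m').toReal - (phiDiv φ n m).toReal)

/-- The chi-squared law with `d` degrees of freedom: the law of the sum of the squares of `d`
independent standard normal variables. -/
def chiSquared (d : ℕ) : Measure ℝ :=
  (Measure.pi fun _ : Fin d => gaussianReal 0 1).map fun z => ∑ i, z i ^ 2

instance chiSquared_isProbabilityMeasure (d : ℕ) : IsProbabilityMeasure (chiSquared d) := by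
  unfold chiSquared
  have h : Measurable fun z : Fin d → ℝ => ∑ i, z i ^ 2 := by fun_prop
  exact Measure.isProbabilityMeasure_map h.aemeasurable

end LoglinearLC

end

/-! After rescaling, the theorem becomes a statement about orthogonal projections. The null mean
vectors are multiples `N ν • μ` of one vector, with several values of `N ν`, so the constant vectors
lie in the column space of each of the two design matrices. Dividing by `N` therefore turns each
model into a set `fitSet X L μ` that does not depend on `ν` (`LMLC.meanSet_eq_smul_fitSet`).

In the chart q_i = μ_i + √μ_i y_i every φ-divergence is φ''(1)/2 · ‖x - y‖² up to a relative error
o(1) (`IsPhi.realDiv_chart_expansion`). The model is tangent at 0 to the subspace W consisting of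
the vectors √μ · Xβ that satisfy the linearized constraints. The rank hypothesis gives, through the
implicit function theorem, that every direction of W is attained, and it passes from the smaller
model to the larger one. Hence every minimum divergence estimator is, to first order, the orthogonal
projection of the normalized table x onto W, whatever φ is
(`minimizer_sub_starProjection_isLittleO`, `estimator_expansion`).

With W' ≤ W the two tangent spaces, T / N and S / N both equal ‖P_W x - P_W' x‖² + o(‖x‖²); for S
this is Pythagoras. The leading term is the squared norm of the projection of x onto W'ᗮ ⊓ W, a
space of dimension (t - c - r) - (t' - c - r').

Up to here everything is deterministic, on tables with the prescribed totals. Probability enters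
through characteristic functions: the multinomial theorem computes them exactly, and on directions
compatible with the fixed totals √N · x converges to a standard Gaussian
(`tendsto_integral_cexp_tableLaw`). Tightness makes the remainder negligible in probability
(`tendstoInDistribution_chiSquared`). -/

namespace LoglinearLC

open Asymptotics Topology

/-! ### Minimum distance problems over a set with a tangent space -/

section MinimumDistance

variable {ι E : Type*} [NormedAddCommGroup E] {l : Filter ι}

lemma isLittleO_sq_norm_sub_sq_norm {u v x : ι → E} (h : (fun i => u i - v i) =o[l] x)
    (hv : v =O[l] x) : (fun i => ‖u i‖ ^ 2 - ‖v i‖ ^ 2) =o[l] fun i => ‖x i‖ ^ 2 := by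
  have hu : u =O[l] x := by simpa using h.isBigO.add hv
  have h1 : (fun i => ‖u i‖ - ‖v i‖) =o[l] fun i => ‖x i‖ :=
    IsBigO.trans_isLittleO
      (.of_norm_le fun i => by simpa using abs_norm_sub_norm_le (u i) (v i)) h.norm_norm
  have h2 : (fun i => ‖u i‖ + ‖v i‖) =O[l] fun i => ‖x i‖ := hu.norm_norm.add hv.norm_norm
  refine (h1.mul_isBigO h2).congr (fun i => by ring) (fun i => by ring)

variable {G : E → E → ℝ} {a : ℝ}

lemma quadratic_expansion_comp
    (hG : (fun z : E × E => G z.1 z.2 - a * ‖z.1 - z.2‖ ^ 2) =o[𝓝 0] fun z => ‖z.1 - z.2‖ ^ 2)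
    {x y : ι → E} (hx : Tendsto x l (𝓝 0)) (hy : Tendsto y l (𝓝 0)) :
    (fun i => G (x i) (y i) - a * ‖x i - y i‖ ^ 2) =o[l] fun i => ‖x i - y i‖ ^ 2 := by
  have : Tendsto (fun i => (x i, y i)) l (𝓝 (0 : E × E)) := hx.prodMk_nhds hy
  exact hG.comp_tendsto this

/-- The expansion of a divergence along `u` and `v`, whose linear approximations are `u'`, `v'`. -/
lemma divergence_expansion
    (hG : (fun z : E × E => G z.1 z.2 - a * ‖z.1 - z.2‖ ^ 2) =o[𝓝 0] fun z => ‖z.1 - z.2‖ ^ 2)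
    {x u v u' v' : ι → E} (hx : Tendsto x l (𝓝 0))
    (hu : (fun i => u i - u' i) =o[l] x) (hv : (fun i => v i - v' i) =o[l] x)
    (hu' : u' =O[l] x) (hv' : v' =O[l] x) :
    (fun i => G (u i) (v i) - a * ‖u' i - v' i‖ ^ 2) =o[l] fun i => ‖x i‖ ^ 2 := by
  have hu0 : u =O[l] x := by simpa using hu.isBigO.add hu'
  have hv0 : v =O[l] x := by simpa using hv.isBigO.add hv'
  have h1 := (quadratic_expansion_comp hG (hu0.trans_tendsto hx) (hv0.trans_tendsto hx)).trans_isBigO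
    ((hu0.sub hv0).norm_norm.pow 2)
  have h2 : (fun i => ‖u i - v i‖ ^ 2 - ‖u' i - v' i‖ ^ 2) =o[l] fun i => ‖x i‖ ^ 2 :=
    isLittleO_sq_norm_sub_sq_norm ((hu.sub hv).congr_left fun i => by abel) (hu'.sub hv')
  refine (h1.add (h2.const_mul_left a)).congr_left fun i => by ring

variable [InnerProductSpace ℝ E] {A : Set E} {W : Submodule ℝ E} [W.HasOrthogonalProjection]

/-- A consistent minimizer over a set which is tangent to the subspace `W` at `0`, of a divergence
which is quadratic to second order, is to first order the orthogonal projection onto `W`. -/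
theorem minimizer_sub_starProjection_isLittleO (ha : 0 < a)
    (hG : (fun z : E × E => G z.1 z.2 - a * ‖z.1 - z.2‖ ^ 2) =o[𝓝 0] fun z => ‖z.1 - z.2‖ ^ 2)
    (h0 : (0 : E) ∈ A)
    (hin : (fun y => y - W.starProjection y) =o[𝓝[A] 0] id)
    {g : E → E} (hgA : ∀ᶠ x in 𝓝 0, g x ∈ A)
    (hg : (fun x => g x - W.starProjection x) =o[𝓝 0] id)
    {x y : ι → E} (hx : Tendsto x l (𝓝 0)) (hy : Tendsto y l (𝓝 0))
    (hyA : ∀ᶠ i in l, y i ∈ A) (hmin : ∀ᶠ i in l, ∀ z ∈ A, G (x i) (y i) ≤ G (x i) z) :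
    (fun i => y i - W.starProjection (x i)) =o[l] x := by
  set P := W.starProjection
  have hGxy := quadratic_expansion_comp hG hx hy
  have hGx0 := quadratic_expansion_comp hG hx (tendsto_const_nhds (x := (0 : E)))
  have hPx : (fun i => P (x i)) =O[l] x := P.isBigO_comp x l
  -- Comparison with the competitor 0 ∈ A: a/2 · ‖x - y‖² ≤ G x y ≤ G x 0 ≤ 2a · ‖x‖², so ‖x - y‖ ≤
  -- 2‖x‖ and ‖y‖ ≤ 3‖x‖.
  have hyx : y =O[l] x := by
    refine IsBigO.of_bound 4 ?_
    filter_upwards [hGxy.def (half_pos ha), hGx0.def ha, hmin] with i h1 h2 h3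
    have h4 := h3 0 h0
    simp only [sub_zero, Real.norm_eq_abs, abs_pow, abs_norm] at h1 h2
    have h5 := (abs_le.1 h1).1
    have h6 := (abs_le.1 h2).2
    have h7 : ‖x i - y i‖ ^ 2 ≤ (2 * ‖x i‖) ^ 2 := by
      have : a * ‖x i - y i‖ ^ 2 ≤ a * (2 * ‖x i‖) ^ 2 := by linarith
      exact le_of_mul_le_mul_left this ha
    have h8 := abs_le_of_sq_le_sq h7 (by positivity)
    have h9 : ‖y i‖ ≤ ‖x i‖ + ‖x i - y i‖ := by
      simpa using norm_sub_le (x i) (x i - y i)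
    have := le_abs_self ‖x i - y i‖
    linarith [norm_nonneg (x i)]
  have hy' : Tendsto y l (𝓝[A] 0) := tendsto_nhdsWithin_iff.2 ⟨hy, hyA⟩
  have hPy : (fun i => y i - P (y i)) =o[l] x := (hin.comp_tendsto hy').trans_isBigO hyx
  have hgx : (fun i => g (x i) - P (x i)) =o[l] x := hg.comp_tendsto hx
  have hgx0 : (fun i => g (x i)) =O[l] x := by simpa using hgx.isBigO.add hPx
  have hE1 := hGxy.trans_isBigO (((isBigO_refl x l).sub hyx).norm_norm.pow 2)
  have hE2 := (quadratic_expansion_comp hG hx (hgx0.trans_tendsto hx)).trans_isBigO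
    (((isBigO_refl x l).sub hgx0).norm_norm.pow 2)
  have hE3 : (fun i => ‖x i - g (x i)‖ ^ 2 - ‖x i - P (x i)‖ ^ 2) =o[l] fun i => ‖x i‖ ^ 2 :=
    isLittleO_sq_norm_sub_sq_norm ((hgx.neg_left).congr_left fun i => by simp [sub_eq_add_neg]; abel)
      ((isBigO_refl x l).sub hPx)
  have hE4 : (fun i => ‖x i - y i‖ ^ 2 - ‖x i - P (y i)‖ ^ 2) =o[l] fun i => ‖x i‖ ^ 2 :=
    isLittleO_sq_norm_sub_sq_norm ((hPy.neg_left).congr_left fun i => by simp)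
      ((isBigO_refl x l).sub ((P.isBigO_comp y l).trans hyx))
  -- The combined error is a⁻¹ (G x (g x) - G x y) + ‖x - P y‖² - ‖x - P x‖². By Pythagoras the last
  -- two terms make ‖P x - P y‖², and the first is nonnegative since g x ∈ A; hence ‖P x - P y‖² =
  -- o(‖x‖²).
  have hE := (((hE2.sub hE1).add (hE3.const_mul_left a)).sub (hE4.const_mul_left a)).const_mul_left
    a⁻¹
  have hpyth : ∀ i, ‖x i - P (y i)‖ ^ 2 = ‖x i - P (x i)‖ ^ 2 + ‖P (x i) - P (y i)‖ ^ 2 := by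
    intro i
    have horth : inner ℝ (x i - P (x i)) (P (x i) - P (y i)) = 0 :=
      (W.mem_orthogonal' _).1 (W.sub_starProjection_mem_orthogonal (x i)) _
        (W.sub_mem (W.starProjection_apply_mem _) (W.starProjection_apply_mem _))
    have := norm_add_sq_eq_norm_sq_add_norm_sq_real horth
    rw [sub_add_sub_cancel] at this
    simpa [pow_two] using this
  have hPP : (fun i => P (x i) - P (y i)) =o[l] x := by
    have h2 : (fun i => ‖P (x i) - P (y i)‖ ^ 2) =o[l] fun i => ‖x i‖ ^ 2 := by
      refine IsBigO.trans_isLittleO (IsBigO.of_bound 1 ?_) hE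
      filter_upwards [hmin, hx.eventually hgA] with i h1 h2
      have h3 := h1 _ h2
      rw [one_mul, Real.norm_of_nonneg (by positivity)]
      refine le_trans ?_ (le_abs_self _)
      have h4 := hpyth i
      rw [le_inv_mul_iff₀ ha]
      nlinarith
    exact (h2.of_pow two_ne_zero).of_norm_norm
  refine (hPy.sub hPP).congr_left fun i => by abel

/-- Gluing of linear maps: some linear map vanishes on `K` and equals `id - P` on `U`, with `P` the
orthogonal projection onto `U ⊓ K`. -/
lemma exists_linearMap_eq_sub_starProjection (U K : Submodule ℝ E)
    [(U ⊓ K).HasOrthogonalProjection] :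
    ∃ H : E →ₗ[ℝ] E, (∀ x ∈ K, H x = 0) ∧
      ∀ x ∈ U, H x = x - (U ⊓ K).starProjection x := by
  let F : U →ₗ[ℝ] E :=
    (LinearMap.id - ((U ⊓ K).starProjection : E →L[ℝ] E).toLinearMap).comp U.subtype
  let fU : E →ₗ.[ℝ] E := ⟨U, F⟩
  let fK : E →ₗ.[ℝ] E := ⟨K, 0⟩
  have hagree : ∀ (x : fU.domain) (y : fK.domain), (x : E) = y → fU x = fK y := by
    rintro ⟨x, hx⟩ ⟨y, hy⟩ (rfl : x = y)
    have : (U ⊓ K).starProjection x = x := Submodule.starProjection_eq_self_iff.2 ⟨hx, hy⟩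
    change x - (U ⊓ K).starProjection x = 0
    rw [this, sub_self]
  obtain ⟨H, hH⟩ := LinearMap.exists_extend (fU.sup fK hagree).toFun
  have hH' : ∀ x (hx : x ∈ (fU.sup fK hagree).domain), H x = (fU.sup fK hagree) ⟨x, hx⟩ :=
    fun x hx => LinearMap.congr_fun hH ⟨x, hx⟩
  refine ⟨H, fun x hx => ?_, fun x hx => ?_⟩
  · rw [hH' x (Submodule.mem_sup_right hx)]
    exact ((LinearPMap.right_le_sup fU fK hagree).2 (x := ⟨x, hx⟩) rfl).symm
  · rw [hH' x (Submodule.mem_sup_left hx)]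
    exact ((LinearPMap.left_le_sup fU fK hagree).2 (x := ⟨x, hx⟩) rfl).symm

/-- In finite dimension a vector of `K` that is close to `U` is close to `U ⊓ K`. With `H` zero on
`K` and `id - P` on `U`, the identity y - P y = (y - u) - P (y - u) - H (y - u) bounds the distance
by a multiple of ‖y - u‖. -/
lemma sub_starProjection_isLittleO_of_mem_inf [FiniteDimensional ℝ E] (U K : Submodule ℝ E)
    {y u : ι → E} (hK : ∀ᶠ i in l, y i ∈ K) (hU : ∀ᶠ i in l, u i ∈ U)
    (h : (fun i => y i - u i) =o[l] y) :
    (fun i => y i - (U ⊓ K).starProjection (y i)) =o[l] y := by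
  obtain ⟨H, hHK, hHU⟩ := exists_linearMap_eq_sub_starProjection U K
  set P := (U ⊓ K).starProjection
  have h1 : (fun i => P (y i - u i)) =o[l] y := (P.isBigO_comp _ l).trans_isLittleO h
  have h2 : (fun i => H.toContinuousLinearMap (y i - u i)) =o[l] y :=
    (ContinuousLinearMap.isBigO_comp _ _ l).trans_isLittleO h
  refine ((h.sub h1).sub h2).congr' ?_ .rfl
  filter_upwards [hK, hU] with i hi hi'
  simp only [map_sub, LinearMap.coe_toContinuousLinearMap', hHK _ hi, hHU _ hi']
  abel

end MinimumDistance

end LoglinearLC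

namespace LoglinearLC

open Asymptotics Topology

/-! ### The convex functions φ: expansion at 1 and linear growth -/

section PhiFunctions

variable {φ : ℝ → EReal}

lemma IsPhi.coe_realVersion (hφ : IsPhi φ) {x : ℝ} (hx : 0 < x) : (realVersion φ x : EReal) = φ x :=
  EReal.coe_toReal (hφ.finite_of_pos x hx).2 (hφ.finite_of_pos x hx).1

lemma IsPhi.realVersion_one (hφ : IsPhi φ) : realVersion φ 1 = 0 := by
  simp [realVersion, hφ.map_one]

lemma IsPhi.convexOn (hφ : IsPhi φ) : ConvexOn ℝ (Set.Ioi 0) (realVersion φ) := by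
  refine ⟨convex_Ioi 0, fun x hx y hy a b ha hb hab => ?_⟩
  have h := hφ.convex x y a b (le_of_lt hx) (le_of_lt hy) ha hb hab
  have hxy : 0 < a * x + b * y := (convex_Ioi (0 : ℝ)) hx hy ha hb hab
  rw [← hφ.coe_realVersion hx, ← hφ.coe_realVersion hy, ← hφ.coe_realVersion hxy] at h
  exact_mod_cast h

/-- `deriv` takes the value 0 where there is no derivative, so positivity of φ''(1) already contains
the differentiability of φ' at 1. -/
lemma IsPhi.hasDerivAt_deriv_one (hφ : IsPhi φ) :
    HasDerivAt (deriv (realVersion φ)) (secondDerivOne φ) 1 :=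
  (differentiableAt_of_deriv_ne_zero hφ.secondDeriv_one_pos.ne').hasDerivAt

/-- φ'' is only known to exist at 1. So φ' is expanded to first order at 1 and the mean value
inequality is applied on the segment from 1 to x, inside a ball of radius at most 1 to remain in (0,
∞). -/
lemma IsPhi.peano (hφ : IsPhi φ) :
    (fun x => realVersion φ x - secondDerivOne φ / 2 * (x - 1) ^ 2) =o[𝓝 1]
      fun x => (x - 1) ^ 2 := by
  set f := realVersion φ
  set a := secondDerivOne φ
  have hd := hφ.hasDerivAt_deriv_one
  rw [hasDerivAt_iff_isLittleO, hφ.deriv_one] at hd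
  rw [isLittleO_iff] at hd ⊢
  intro c hc
  obtain ⟨δ, hδ, hball⟩ := Metric.eventually_nhds_iff_ball.1 (hd hc)
  refine Metric.eventually_nhds_iff_ball.2 ⟨min δ 1, by positivity, fun x hx => ?_⟩
  have hg : ∀ z : ℝ, 0 < z → HasDerivAt (fun z => f z - a / 2 * (z - 1) ^ 2)
      (deriv f z - a * (z - 1)) z := by
    intro z hz
    have h1 : HasDerivAt f (deriv f z) z :=
      ((hφ.differentiableOn z hz).differentiableAt (Ioi_mem_nhds hz)).hasDerivAt
    have h2 : HasDerivAt (fun z : ℝ => a / 2 * (z - 1) ^ 2) (a / 2 * (2 * (z - 1))) z := by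
      simpa using (((hasDerivAt_id z).sub_const 1).pow 2).const_mul (a / 2)
    convert! h1.sub h2 using 1
    ring
  have hseg : ∀ z ∈ segment ℝ 1 x, 0 < z ∧ |z - 1| ≤ |x - 1| ∧ z ∈ Metric.ball (1 : ℝ) δ := by
    intro z hz
    have h1 : |z - 1| ≤ |x - 1| := by
      have := norm_sub_le_of_mem_segment hz
      simpa using this
    have h2 : |x - 1| < min δ 1 := by simpa [Real.dist_eq] using hx
    refine ⟨?_, h1, ?_⟩
    · have := (abs_lt.1 (h1.trans_lt (h2.trans_le (min_le_right _ _)))).1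
      linarith
    · simpa [Real.dist_eq] using h1.trans_lt (h2.trans_le (min_le_left _ _))
  have hmv := (convex_segment (1 : ℝ) x).norm_image_sub_le_of_norm_hasDerivWithin_le
    (f := fun z => f z - a / 2 * (z - 1) ^ 2) (C := c * |x - 1|)
    (fun z hz => (hg z (hseg z hz).1).hasDerivWithinAt)
    (fun z hz => by
      have h1 := hball z (hseg z hz).2.2
      simp only [sub_zero, smul_eq_mul, Real.norm_eq_abs] at h1
      rw [Real.norm_eq_abs, mul_comm a]
      exact h1.trans (mul_le_mul_of_nonneg_left (hseg z hz).2.1 hc.le))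
    (left_mem_segment ℝ 1 x) (right_mem_segment ℝ 1 x)
  simp only [hφ.realVersion_one, f, sub_self] at hmv
  simp only [ne_eq, OfNat.ofNat_ne_zero, not_false_eq_true, zero_pow, mul_zero, sub_zero] at hmv
  simp only [Real.norm_eq_abs, abs_pow] at hmv ⊢
  rwa [pow_two |x - 1|, ← mul_assoc]

/-- Away from `1`, the function `φ` grows at least linearly in the distance to `1`. -/
lemma IsPhi.exists_linear_lower_bound (hφ : IsPhi φ) {ρ : ℝ} (hρ : 0 < ρ) :
    ∃ κ > 0, ∀ x, 0 < x → ρ ≤ |x - 1| → κ * |x - 1| ≤ realVersion φ x := by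
  set f := realVersion φ
  set a := secondDerivOne φ
  have ha : 0 < a := hφ.secondDeriv_one_pos
  have hp := hφ.peano.def (show 0 < a / 4 by positivity)
  obtain ⟨δ, hδ, hball⟩ := Metric.eventually_nhds_iff_ball.1 hp
  obtain ⟨r, hr0, hr⟩ : ∃ r : ℝ, 0 < r ∧ r < min ρ (min δ 1) := exists_between (by positivity)
  have hrρ : r < ρ := hr.trans_le (min_le_left _ _)
  have hrδ : r < δ := hr.trans_le ((min_le_right _ _).trans (min_le_left _ _))
  have hr1 : r < 1 := hr.trans_le ((min_le_right _ _).trans (min_le_right _ _))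
  have hlow : ∀ z : ℝ, |z - 1| = r → a / 4 * r ^ 2 ≤ f z := by
    intro z hz
    have := hball z (by simpa [Real.dist_eq, hz] using hrδ)
    rw [Real.norm_eq_abs, Real.norm_eq_abs, abs_pow, hz, ← sq_abs (z - 1), hz] at this
    linarith [(abs_le.1 this).1]
  refine ⟨a / 4 * r, by positivity, fun x hx hxρ => ?_⟩
  set s := |x - 1|
  have hs : 0 < s := hρ.trans_le hxρ
  have hrs : r / s ≤ 1 := by rw [div_le_one hs]; linarith
  -- The point of the segment from 1 to `x` at distance `r` from 1. As `f 1 = 0`, convexity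
  -- transfers the lower bound a/4 · r² there to a bound at `x` that is linear in `s`.
  have hz : f ((r / s) • x + (1 - r / s) • (1 : ℝ)) ≤ (r / s) • f x + (1 - r / s) • f 1 :=
    hφ.convexOn.2 hx (Set.mem_Ioi.2 one_pos) (by positivity) (by linarith) (by ring)
  have habs : |((r / s) • x + (1 - r / s) • (1 : ℝ)) - 1| = r := by
    have : ((r / s) • x + (1 - r / s) • (1 : ℝ)) - 1 = r / s * (x - 1) := by
      simp only [smul_eq_mul]; ring
    rw [this, abs_mul, abs_of_pos (by positivity), div_mul_cancel₀ _ hs.ne']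
  have h1 := (hlow _ habs).trans hz
  rw [show f 1 = 0 from hφ.realVersion_one, smul_zero, add_zero, smul_eq_mul] at h1
  have h1' : a / 4 * r ^ 2 * s ≤ r * f x := by
    have := mul_le_mul_of_nonneg_right h1 hs.le
    rwa [mul_right_comm (r / s), div_mul_cancel₀ _ hs.ne'] at this
  have h2 : r * (a / 4 * r * s) ≤ r * f x := by linarith
  exact le_of_mul_le_mul_left h2 hr0

lemma IsPhi.realVersion_nonneg (hφ : IsPhi φ) {x : ℝ} (hx : 0 < x) : 0 ≤ realVersion φ x := by
  rcases eq_or_ne x 1 with rfl | h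
  · exact hφ.realVersion_one.ge
  · obtain ⟨κ, hκ, h1⟩ := hφ.exists_linear_lower_bound (abs_pos.2 (sub_ne_zero.2 h))
    exact le_trans (by positivity) (h1 x hx le_rfl)

lemma IsPhi.continuousOn (hφ : IsPhi φ) : ContinuousOn (realVersion φ) (Set.Ioi 0) :=
  hφ.differentiableOn.continuousOn

end PhiFunctions

/-! ### Divergences of positive vectors: consistency and existence of minimizers -/

section Divergence

variable {k : ℕ} {φ : ℝ → EReal}

/-- The divergence between positive vectors, as a real number. -/
noncomputable def realDiv (φ : ℝ → EReal) (p q : Fin k → ℝ) : ℝ :=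
  ∑ i, q i * realVersion φ (p i / q i)

lemma IsPhi.phiDiv_eq (hφ : IsPhi φ) {p q : Fin k → ℝ} (hp : ∀ i, 0 < p i) (hq : ∀ i, 0 < q i) :
    phiDiv φ p q = (realDiv φ p q : EReal) := by
  have hcoe : ∀ (s : Finset (Fin k)) (g : Fin k → ℝ),
      ((∑ i ∈ s, g i : ℝ) : EReal) = ∑ i ∈ s, (g i : EReal) := fun s g => by
    induction s using Finset.cons_induction with
    | empty => simp
    | cons i s hi ih => rw [Finset.sum_cons, Finset.sum_cons, EReal.coe_add, ih]
  rw [phiDiv, realDiv, hcoe]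
  refine Finset.sum_congr rfl fun i _ => ?_
  rw [divTerm, if_neg (hq i).ne', ← hφ.coe_realVersion (div_pos (hp i) (hq i)), EReal.coe_mul]

lemma realDiv_smul {N : ℝ} (hN : N ≠ 0) (p q : Fin k → ℝ) :
    realDiv φ (N • p) (N • q) = N * realDiv φ p q := by
  simp only [realDiv, Pi.smul_apply, smul_eq_mul, Finset.mul_sum, mul_assoc]
  exact Finset.sum_congr rfl fun i _ => by rw [mul_div_mul_left _ _ hN]

lemma IsPhi.realDiv_self (hφ : IsPhi φ) {q : Fin k → ℝ} (hq : ∀ i, 0 < q i) :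
    realDiv φ q q = 0 :=
  Finset.sum_eq_zero fun i _ => by rw [div_self (hq i).ne', hφ.realVersion_one, mul_zero]

lemma IsPhi.continuousOn_realDiv (hφ : IsPhi φ) :
    ContinuousOn (fun z : (Fin k → ℝ) × (Fin k → ℝ) => realDiv φ z.1 z.2)
      {z | (∀ i, 0 < z.1 i) ∧ ∀ i, 0 < z.2 i} := by
  refine continuousOn_finsetSum _ fun i _ => ContinuousOn.mul (by fun_prop) ?_
  refine hφ.continuousOn.comp (ContinuousOn.div (by fun_prop) (by fun_prop)
    fun z hz => (hz.2 i).ne') fun z hz => div_pos (hz.1 i) (hz.2 i)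

lemma IsPhi.tendsto_realDiv_const (hφ : IsPhi φ) {μ : Fin k → ℝ} (hμ : ∀ i, 0 < μ i) :
    Tendsto (fun p => realDiv φ p μ) (𝓝 μ) (𝓝 0) := by
  have hopen : IsOpen {z : (Fin k → ℝ) × (Fin k → ℝ) | (∀ i, 0 < z.1 i) ∧ ∀ i, 0 < z.2 i} := by
    simp only [Set.ofPred_and, Set.ofPred_forall]
    exact (isOpen_iInter_of_finite fun i => isOpen_lt (by fun_prop) (by fun_prop)).inter
      (isOpen_iInter_of_finite fun i => isOpen_lt (by fun_prop) (by fun_prop))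
  have h1 : ContinuousAt (fun z : (Fin k → ℝ) × (Fin k → ℝ) => realDiv φ z.1 z.2) (μ, μ) :=
    hφ.continuousOn_realDiv.continuousAt (hopen.mem_nhds ⟨hμ, hμ⟩)
  have h2 : Tendsto (fun p : Fin k → ℝ => (p, μ)) (𝓝 μ) (𝓝 (μ, μ)) :=
    (Continuous.prodMk_left μ).tendsto μ
  simpa [Function.comp_def, hφ.realDiv_self hμ] using h1.tendsto.comp h2

/-- Small divergence from a table close to `μ` forces closeness to `μ`. -/
lemma IsPhi.close_of_realDiv_small (hφ : IsPhi φ) {μ : Fin k → ℝ} (hμ : ∀ i, 0 < μ i)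
    {ε : ℝ} (hε : 0 < ε) :
    ∀ᶠ p in 𝓝 μ, ∀ q : Fin k → ℝ, (∀ i, 0 < q i) → realDiv φ p q ≤ realDiv φ p μ →
      ∀ i, |q i - μ i| < ε := by
  set B : ℝ := ∑ i, μ i + 1
  have hB : ∀ i, μ i < B := fun i => by
    have := Finset.single_le_sum (f := μ) (fun j _ => (hμ j).le) (Finset.mem_univ i)
    simp only [B]; linarith
  have hB0 : 0 < B := add_pos_of_nonneg_of_pos (Finset.sum_nonneg fun i _ => (hμ i).le) one_pos
  -- If |p_i / q_i - 1| < ρ, the bound 1/2 gives q_i ≤ 2 p_i ≤ 2B, and then ε / (8B) gives |q_i -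
  -- p_i| ≤ ε/4. If not, the linear lower bound on φ controls |q_i - p_i| by a single term of the
  -- divergence.
  set ρ : ℝ := min (1 / 2) (ε / (8 * B))
  have hρ : 0 < ρ := by positivity
  obtain ⟨κ, hκ, hlow⟩ := hφ.exists_linear_lower_bound hρ
  have e1 : ∀ᶠ p in 𝓝 μ, realDiv φ p μ < κ * (ε / 4) :=
    (hφ.tendsto_realDiv_const hμ).eventually_lt_const (by positivity)
  have e2 : ∀ᶠ p in 𝓝 μ, ∀ i : Fin k, 0 < p i ∧ p i < B ∧ |p i - μ i| < ε / 4 := by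
    refine eventually_all.2 fun i => ?_
    have hc : Tendsto (fun p : Fin k → ℝ => p i) (𝓝 μ) (𝓝 (μ i)) :=
      (continuous_apply i).tendsto μ
    refine (hc.eventually_const_lt (hμ i)).and ((hc.eventually_lt_const (hB i)).and ?_)
    simpa [Real.dist_eq] using hc.eventually (Metric.ball_mem_nhds (μ i) (show 0 < ε / 4 by positivity))
  filter_upwards [e1, e2] with p h1 h2 q hq hle i
  obtain ⟨hp0, hpB, hpμ⟩ := h2 i
  have hpq : |q i - p i| ≤ ε / 2 := by
    have hrel : |p i / q i - 1| * q i = |q i - p i| := by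
      rw [abs_sub_comm (q i), ← abs_of_pos (hq i), ← abs_mul, abs_of_pos (hq i), sub_mul,
        div_mul_cancel₀ _ (hq i).ne', one_mul]
    rcases le_or_gt ρ |p i / q i - 1| with h | h
    · have h3 := hlow _ (div_pos hp0 (hq i)) h
      have h4 : q i * realVersion φ (p i / q i) ≤ realDiv φ p q :=
        Finset.single_le_sum (f := fun i => q i * realVersion φ (p i / q i))
          (fun j _ => mul_nonneg (hq j).le
            (hφ.realVersion_nonneg (div_pos (h2 j).1 (hq j)))) (Finset.mem_univ i)
      have h5 : κ * |q i - p i| ≤ q i * realVersion φ (p i / q i) := by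
        rw [← hrel]
        nlinarith [hq i]
      have h6 : κ * |q i - p i| ≤ κ * (ε / 4) := by linarith
      linarith [le_of_mul_le_mul_left h6 hκ]
    · have h3 : |q i - p i| ≤ ρ * q i := by
        rw [← hrel]
        exact mul_le_mul_of_nonneg_right h.le (hq i).le
      have h4 : ρ ≤ 1 / 2 := min_le_left _ _
      have h5 : q i ≤ 2 * p i := by
        have := (abs_le.1 h3).2
        nlinarith [hq i]
      have h6 : ρ ≤ ε / (8 * B) := min_le_right _ _
      have h7 : ρ * q i ≤ ε / (8 * B) * (2 * B) :=
        mul_le_mul h6 (by linarith) (hq i).le (by positivity)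
      have h8 : ε / (8 * B) * (2 * B) = ε / 4 := by field_simp; norm_num
      linarith
  have := abs_sub_le (q i) (p i) (μ i)
  linarith

/-- Existence of a minimizer over a relatively closed set of positive vectors, for tables close to
one of its elements. -/
lemma IsPhi.exists_minimizer (hφ : IsPhi φ) {μ : Fin k → ℝ} (hμ : ∀ i, 0 < μ i)
    {A : Set (Fin k → ℝ)} (hA : ∀ q ∈ A, ∀ i, 0 < q i) (hμA : μ ∈ A)
    (hclosed : ∀ K : Set (Fin k → ℝ), IsCompact K → (∀ q ∈ K, ∀ i, 0 < q i) → IsCompact (K ∩ A)) :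
    ∀ᶠ p in 𝓝 μ, ∃ q ∈ A, ∀ q' ∈ A, realDiv φ p q ≤ realDiv φ p q' := by
  obtain ⟨ε, hε, hεμ⟩ : ∃ ε > 0, ∀ i, ε < μ i := by
    have : ∀ᶠ ε in 𝓝[>] (0 : ℝ), ∀ i, ε < μ i := eventually_all.2 fun i =>
      (eventually_lt_nhds (hμ i)).filter_mono nhdsWithin_le_nhds
    obtain ⟨ε, h1, h2⟩ := (this.and self_mem_nhdsWithin).exists
    exact ⟨ε, h2, h1⟩
  -- A box around `μ` inside the positive orthant. For `p` near `μ`, points of `A` outside it have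
  -- larger divergence than `μ` itself, so minimizing over the compact set `K ∩ A` suffices.
  set K : Set (Fin k → ℝ) := Set.Icc (fun i => μ i - ε) (fun i => μ i + ε)
  have hKpos : ∀ q ∈ K, ∀ i, 0 < q i := fun q hq i => by
    have := hq.1 i
    have := hεμ i
    simp only at *
    linarith
  have hcomp : IsCompact (K ∩ A) := hclosed K isCompact_Icc hKpos
  have hμK : μ ∈ K ∩ A :=
    ⟨⟨fun i => by simp only; linarith, fun i => by simp only; linarith⟩, hμA⟩
  have e2 : ∀ᶠ p in 𝓝 μ, ∀ i : Fin k, 0 < p i := eventually_all.2 fun i =>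
    ((continuous_apply i).tendsto μ).eventually_const_lt (hμ i)
  filter_upwards [hφ.close_of_realDiv_small hμ hε, e2] with p hp hp0
  have hcont : ContinuousOn (fun q => realDiv φ p q) (K ∩ A) :=
    hφ.continuousOn_realDiv.comp (f := fun q : Fin k → ℝ => (p, q)) (by fun_prop)
      fun q hq => ⟨hp0, hA q hq.2⟩
  obtain ⟨q, hq, hmin⟩ := hcomp.exists_isMinOn ⟨μ, hμK⟩ hcont
  refine ⟨q, hq.2, fun q' hq' => ?_⟩
  by_cases hK : q' ∈ K
  · exact hmin ⟨hK, hq'⟩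
  · have h1 : realDiv φ p μ < realDiv φ p q' := by
      by_contra! hle
      refine hK ⟨fun i => ?_, fun i => ?_⟩ <;>
      · have := abs_lt.1 (hp q' (hA q' hq') hle i)
        simp only
        linarith
    exact (hmin hμK).trans h1.le

end Divergence

/-! ### The chart in which divergences are Euclidean to second order -/

section Chart

variable {k : ℕ} {φ : ℝ → EReal}

/-- The chart around `μ` in which divergences are Euclidean to second order. -/
noncomputable def chart (μ : Fin k → ℝ) (y : EuclideanSpace ℝ (Fin k)) : Fin k → ℝ :=
  fun i => μ i + √(μ i) * y i

/-- The inverse of `chart`. -/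
noncomputable def chartInv (μ : Fin k → ℝ) (q : Fin k → ℝ) : EuclideanSpace ℝ (Fin k) :=
  WithLp.toLp 2 fun i => (q i - μ i) / √(μ i)

lemma chart_zero (μ : Fin k → ℝ) : chart μ 0 = μ := by ext i; simp [chart]

lemma chart_chartInv {μ : Fin k → ℝ} (hμ : ∀ i, 0 < μ i) (q : Fin k → ℝ) :
    chart μ (chartInv μ q) = q := by
  ext i
  have := (Real.sqrt_pos.2 (hμ i)).ne'
  simp only [chart, chartInv]
  field_simp
  ring

lemma continuous_chart (μ : Fin k → ℝ) : Continuous (chart μ) := by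
  unfold chart; fun_prop

lemma continuous_chartInv (μ : Fin k → ℝ) : Continuous (chartInv μ) := by
  unfold chartInv; fun_prop

/-- With q = μ + √μ z₂, the ratio minus 1 is √μ (z₁ - z₂) / q, so Peano's expansion gives a/2 ·
(μ/q) (z₁ - z₂)² and μ/q → 1. The error is relative to z₁ - z₂, not merely to z. -/
lemma IsPhi.term_expansion (hφ : IsPhi φ) {μ : ℝ} (hμ : 0 < μ) :
    (fun z : ℝ × ℝ => (μ + √μ * z.2) * realVersion φ ((μ + √μ * z.1) / (μ + √μ * z.2))
      - secondDerivOne φ / 2 * (z.1 - z.2) ^ 2) =o[𝓝 0] fun z => (z.1 - z.2) ^ 2 := by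
  set a := secondDerivOne φ
  have hs : √μ ^ 2 = μ := Real.sq_sqrt hμ.le
  have hc2 : Tendsto (fun z : ℝ × ℝ => μ + √μ * z.2) (𝓝 0) (𝓝 μ) := by
    have : Continuous fun z : ℝ × ℝ => μ + √μ * z.2 := by fun_prop
    simpa using this.tendsto 0
  have hc1 : Tendsto (fun z : ℝ × ℝ => μ + √μ * z.1) (𝓝 0) (𝓝 μ) := by
    have : Continuous fun z : ℝ × ℝ => μ + √μ * z.1 := by fun_prop
    simpa using this.tendsto 0
  have hpos : ∀ᶠ z : ℝ × ℝ in 𝓝 0, 0 < μ + √μ * z.2 := hc2.eventually_const_lt hμ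
  have hratio : Tendsto (fun z : ℝ × ℝ => (μ + √μ * z.1) / (μ + √μ * z.2)) (𝓝 0) (𝓝 1) := by
    have := hc1.div hc2 hμ.ne'
    rwa [div_self hμ.ne'] at this
  have h1 := hφ.peano.comp_tendsto hratio
  have hq : ∀ᶠ z : ℝ × ℝ in 𝓝 0, ((μ + √μ * z.1) / (μ + √μ * z.2) - 1) ^ 2
      = μ / (μ + √μ * z.2) ^ 2 * (z.1 - z.2) ^ 2 := by
    filter_upwards [hpos] with z hz
    rw [div_sub_one hz.ne', div_pow, show (μ + √μ * z.1 - (μ + √μ * z.2)) ^ 2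
      = √μ ^ 2 * (z.1 - z.2) ^ 2 by ring, hs]
    ring
  have hbd : (fun z : ℝ × ℝ => (μ + √μ * z.2) * (μ / (μ + √μ * z.2) ^ 2)) =O[𝓝 0]
      fun _ => (1 : ℝ) := by
    have : Tendsto (fun z : ℝ × ℝ => (μ + √μ * z.2) * (μ / (μ + √μ * z.2) ^ 2)) (𝓝 0)
        (𝓝 (μ * (μ / μ ^ 2))) :=
      hc2.mul (tendsto_const_nhds.div (hc2.pow 2) (by positivity))
    exact this.isBigO_one ℝ
  have hmain : (fun z : ℝ × ℝ => (μ + √μ * z.2) *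
      (realVersion φ ((μ + √μ * z.1) / (μ + √μ * z.2)) - a / 2 *
        ((μ + √μ * z.1) / (μ + √μ * z.2) - 1) ^ 2)) =o[𝓝 0] fun z => (z.1 - z.2) ^ 2 := by
    refine ((isBigO_refl (fun z : ℝ × ℝ => μ + √μ * z.2) _).mul_isLittleO h1).trans_isBigO ?_
    have := hbd.mul (isBigO_refl (fun z : ℝ × ℝ => (z.1 - z.2) ^ 2) (𝓝 0))
    refine this.congr' ?_ (.of_forall fun z => by simp)
    filter_upwards [hq] with z hz
    simp only [Function.comp_apply, hz]
    ring
  have hrest : (fun z : ℝ × ℝ => a / 2 * (μ / (μ + √μ * z.2) - 1) * (z.1 - z.2) ^ 2) =o[𝓝 0]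
      fun z => (z.1 - z.2) ^ 2 := by
    have h0 : Tendsto (fun z : ℝ × ℝ => a / 2 * (μ / (μ + √μ * z.2) - 1)) (𝓝 0) (𝓝 0) := by
      have := ((tendsto_const_nhds (x := μ)).div hc2 hμ.ne').sub_const 1 |>.const_mul (a / 2)
      simpa [hμ.ne'] using this
    have := (isLittleO_one_iff ℝ).2 h0 |>.mul_isBigO
      (isBigO_refl (fun z : ℝ × ℝ => (z.1 - z.2) ^ 2) (𝓝 0))
    simpa using this
  refine (hmain.add hrest).congr' ?_ .rfl
  filter_upwards [hq, hpos] with z hz hz0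
  rw [hz]
  field_simp
  ring

lemma IsPhi.realDiv_chart_expansion (hφ : IsPhi φ) {μ : Fin k → ℝ} (hμ : ∀ i, 0 < μ i) :
    (fun z : EuclideanSpace ℝ (Fin k) × EuclideanSpace ℝ (Fin k) =>
      realDiv φ (chart μ z.1) (chart μ z.2) - secondDerivOne φ / 2 * ‖z.1 - z.2‖ ^ 2)
      =o[𝓝 0] fun z => ‖z.1 - z.2‖ ^ 2 := by
  have hterm : ∀ i, (fun z : EuclideanSpace ℝ (Fin k) × EuclideanSpace ℝ (Fin k) =>
      chart μ z.2 i * realVersion φ (chart μ z.1 i / chart μ z.2 i)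
        - secondDerivOne φ / 2 * (z.1 i - z.2 i) ^ 2) =o[𝓝 0] fun z => ‖z.1 - z.2‖ ^ 2 := by
    intro i
    have hc : Tendsto (fun z : EuclideanSpace ℝ (Fin k) × EuclideanSpace ℝ (Fin k) =>
        (z.1 i, z.2 i)) (𝓝 0) (𝓝 0) := by
      have : Continuous (fun z : EuclideanSpace ℝ (Fin k) × EuclideanSpace ℝ (Fin k) =>
        (z.1 i, z.2 i)) := by fun_prop
      exact this.tendsto 0
    refine ((hφ.term_expansion (hμ i)).comp_tendsto hc).trans_isBigO (IsBigO.of_norm_le fun z => ?_)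
    have := PiLp.norm_apply_le (z.1 - z.2) i
    simp only [Function.comp_apply, PiLp.sub_apply, norm_pow] at this ⊢
    gcongr
  refine (IsLittleO.sum fun i (_ : i ∈ Finset.univ) => hterm i).congr_left fun z => ?_
  rw [Finset.sum_apply, Finset.sum_sub_distrib, ← Finset.mul_sum, EuclideanSpace.norm_sq_eq, realDiv]
  simp

end Chart

end LoglinearLC

namespace LoglinearLC

open Asymptotics Topology

/-! ### The normalized model and its tangent space -/

section FitSet

variable {k t : ℕ} {J : Type*} {X : Matrix (Fin k) (Fin t) ℝ}
  {L : Matrix (Fin k) J ℝ} {μ : Fin k → ℝ}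

/-- The mean vectors `exp (X θ)` satisfying the same linear constraints as `μ`. -/
def fitSet (X : Matrix (Fin k) (Fin t) ℝ) (L : Matrix (Fin k) J ℝ) (μ : Fin k → ℝ) :
    Set (Fin k → ℝ) :=
  {q | (∃ θ, ∀ i, q i = Real.exp ((X *ᵥ θ) i)) ∧ Lᵀ *ᵥ q = Lᵀ *ᵥ μ}

lemma fitSet_pos {q : Fin k → ℝ} (hq : q ∈ fitSet X L μ) (i : Fin k) : 0 < q i := by
  obtain ⟨⟨θ, hθ⟩, -⟩ := hq
  rw [hθ i]
  exact Real.exp_pos _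

/-- The vectors exp(Xθ) need not form a closed set, since coordinates may tend to 0. Away from the
boundary of the orthant, taking logarithms turns the condition into membership in a linear subspace,
which is closed. -/
lemma isCompact_inter_fitSet (X : Matrix (Fin k) (Fin t) ℝ) (L : Matrix (Fin k) J ℝ)
    (μ : Fin k → ℝ) {K : Set (Fin k → ℝ)} (hK : IsCompact K) (hpos : ∀ q ∈ K, ∀ i, 0 < q i) :
    IsCompact (K ∩ fitSet X L μ) := by
  have hlog : ContinuousOn (fun (q : Fin k → ℝ) i => Real.log (q i)) K :=
    continuousOn_pi.2 fun i => ContinuousOn.log (by fun_prop) fun q hq => (hpos q hq i).ne'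
  have h1 : IsClosed (K ∩ (fun (q : Fin k → ℝ) i => Real.log (q i)) ⁻¹'
      (LinearMap.range X.mulVecLin : Set (Fin k → ℝ))) :=
    hlog.preimage_isClosed_of_isClosed hK.isClosed (Submodule.closed_of_finiteDimensional _)
  have h2 : IsClosed {q : Fin k → ℝ | Lᵀ *ᵥ q = Lᵀ *ᵥ μ} :=
    isClosed_eq (Continuous.matrix_mulVec continuous_const continuous_id) continuous_const
  convert! hK.of_isClosed_subset (h1.inter h2) fun q hq => hq.1.1 using 1
  ext q
  constructor
  · rintro ⟨hq, ⟨θ, hθ⟩, hL⟩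
    refine ⟨⟨hq, θ, ?_⟩, hL⟩
    ext i
    simp only [hθ i, Real.log_exp, Matrix.mulVecLin_apply]
  · rintro ⟨⟨hq, θ, hθ⟩, hL⟩
    refine ⟨hq, ⟨θ, fun i => ?_⟩, hL⟩
    have := congrFun hθ i
    rw [Matrix.mulVecLin_apply] at this
    rw [this, Real.exp_log (hpos q hq i)]

/-- Multiplication by the square root of `μ`, into Euclidean space. -/
noncomputable def sqrtMul (μ : Fin k → ℝ) : (Fin k → ℝ) →ₗ[ℝ] EuclideanSpace ℝ (Fin k) where
  toFun v := WithLp.toLp 2 fun i => √(μ i) * v i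
  map_add' v w := by ext i; simp [mul_add]
  map_smul' c v := by ext i; simp; ring

@[simp] lemma sqrtMul_apply (μ v : Fin k → ℝ) (i : Fin k) : sqrtMul μ v i = √(μ i) * v i := rfl

/-- The linear constraints in the chart around `μ`. -/
noncomputable def constraintSpace (L : Matrix (Fin k) J ℝ) (μ : Fin k → ℝ) :
    Submodule ℝ (EuclideanSpace ℝ (Fin k)) :=
  LinearMap.ker (Lᵀ.mulVecLin.comp
    ((LinearMap.pi fun i => √(μ i) • LinearMap.proj i).comp
      (WithLp.linearEquiv 2 ℝ (Fin k → ℝ)).toLinearMap))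

lemma mem_constraintSpace {y : EuclideanSpace ℝ (Fin k)} :
    y ∈ constraintSpace L μ ↔ Lᵀ *ᵥ (fun i => √(μ i) * y i) = 0 := by
  rw [constraintSpace, LinearMap.mem_ker]
  rfl

/-- The tangent space of `fitSet X L μ` at `μ`, in the chart around `μ`. -/
noncomputable def tangentSpace (X : Matrix (Fin k) (Fin t) ℝ) (L : Matrix (Fin k) J ℝ)
    (μ : Fin k → ℝ) : Submodule ℝ (EuclideanSpace ℝ (Fin k)) :=
  (LinearMap.range X.mulVecLin).map (sqrtMul μ) ⊓ constraintSpace L μ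

lemma sqrtMul_mem_constraintSpace (hμ : ∀ i, 0 < μ i) (β : Fin t → ℝ) :
    sqrtMul μ (X *ᵥ β) ∈ constraintSpace L μ ↔ (Lᵀ * Matrix.diagonal μ * X) *ᵥ β = 0 := by
  rw [mem_constraintSpace, ← Matrix.mulVec_mulVec, ← Matrix.mulVec_mulVec]
  have : (fun i => √(μ i) * sqrtMul μ (X *ᵥ β) i) = Matrix.diagonal μ *ᵥ (X *ᵥ β) := by
    ext i
    rw [Matrix.mulVec_diagonal, sqrtMul_apply, ← mul_assoc, Real.mul_self_sqrt (hμ i).le]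
  rw [this]

lemma transpose_mulVec_chart_eq_iff {y : EuclideanSpace ℝ (Fin k)} :
    Lᵀ *ᵥ chart μ y = Lᵀ *ᵥ μ ↔ y ∈ constraintSpace L μ := by
  rw [mem_constraintSpace, show chart μ y = μ + fun i => √(μ i) * y i from rfl, Matrix.mulVec_add]
  simp

/-- The parametrization of the tangent space by the kernel of the differential of the
constraints. -/
noncomputable def tangentParam (X : Matrix (Fin k) (Fin t) ℝ) (L : Matrix (Fin k) J ℝ)
    (hμ : ∀ i, 0 < μ i) :
    LinearMap.ker (Lᵀ * Matrix.diagonal μ * X).mulVecLin →ₗ[ℝ] tangentSpace X L μ :=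
  (((sqrtMul μ).comp X.mulVecLin).comp (Submodule.subtype _)).codRestrict _ fun β =>
    ⟨⟨X *ᵥ β.1, ⟨β.1, rfl⟩, rfl⟩, (sqrtMul_mem_constraintSpace hμ β.1).2 β.2⟩

lemma tangentParam_surjective (hμ : ∀ i, 0 < μ i) :
    Function.Surjective (tangentParam X L hμ) := by
  rintro ⟨_, ⟨_, ⟨β, rfl⟩, rfl⟩, hK⟩
  exact ⟨⟨β, (sqrtMul_mem_constraintSpace hμ β).1 hK⟩, rfl⟩

/-- Since `X` has full column rank, β ↦ √μ · Xβ identifies the kernel of Lᵀ diag(μ) X with the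
tangent space; rank-nullity does the rest. -/
lemma finrank_tangentSpace (hμ : ∀ i, 0 < μ i) (hX : X.rank = t) :
    Module.finrank ℝ (tangentSpace X L μ) + (Lᵀ * Matrix.diagonal μ * X).rank = t := by
  have hXinj : Function.Injective X.mulVecLin := by
    rw [← LinearMap.ker_eq_bot, ← Submodule.finrank_eq_zero (R := ℝ)]
    have := LinearMap.finrank_range_add_finrank_ker X.mulVecLin
    rw [show Module.finrank ℝ (LinearMap.range X.mulVecLin) = t from hX] at this
    simpa using this
  have hinj : Function.Injective (tangentParam X L hμ) := by
    intro β γ h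
    have h1 : sqrtMul μ (X *ᵥ β.1) = sqrtMul μ (X *ᵥ γ.1) := congrArg Subtype.val h
    refine Subtype.ext (hXinj ?_)
    ext i
    have h2 : √(μ i) * (X *ᵥ β.1) i = √(μ i) * (X *ᵥ γ.1) i := by
      rw [← sqrtMul_apply, h1, sqrtMul_apply]
    exact mul_left_cancel₀ (Real.sqrt_pos.2 (hμ i)).ne' h2
  rw [← (LinearEquiv.ofBijective _ ⟨hinj, tangentParam_surjective hμ⟩).finrank_eq, add_comm]
  exact (LinearMap.finrank_range_add_finrank_ker (Lᵀ * Matrix.diagonal μ * X).mulVecLin).trans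
    (by simp)

/-- `fitSet X L μ` is tangent to `tangentSpace X L μ` at `μ`. -/
lemma sub_starProjection_tangentSpace_isLittleO (hμ : ∀ i, 0 < μ i)
    (hmem : μ ∈ fitSet X L μ) :
    (fun y => y - (tangentSpace X L μ).starProjection y)
      =o[𝓝[{y | chart μ y ∈ fitSet X L μ}] 0] id := by
  obtain ⟨⟨θ₀, hθ₀⟩, -⟩ := hmem
  set A : Set (EuclideanSpace ℝ (Fin k)) := {y | chart μ y ∈ fitSet X L μ}
  -- Points of the model lie exactly in the linear space of constraints, while `u` straightens the
  -- loglinear condition: it maps them into √μ · 𝒞(X). Its derivative at 0 is the identity, because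
  -- √μ · μ⁻¹ · √μ = 1.
  let u : EuclideanSpace ℝ (Fin k) → EuclideanSpace ℝ (Fin k) := fun y =>
    sqrtMul μ fun i => Real.log (chart μ y i) - Real.log (μ i)
  have hu : HasStrictFDerivAt u (ContinuousLinearMap.id ℝ _) 0 := by
    rw [hasStrictFDerivAt_euclidean]
    intro i
    have hs := Real.sqrt_pos.2 (hμ i)
    have h1 : HasStrictFDerivAt (fun y : EuclideanSpace ℝ (Fin k) => y i)
        (PiLp.proj 2 (fun _ => ℝ) i : EuclideanSpace ℝ (Fin k) →L[ℝ] ℝ) 0 :=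
      (PiLp.proj 2 (fun _ => ℝ) i : EuclideanSpace ℝ (Fin k) →L[ℝ] ℝ).hasStrictFDerivAt
    have h2 := (((h1.const_mul (√(μ i))).const_add (μ i)).log
      (by simpa using (hμ i).ne')).sub_const (Real.log (μ i)) |>.const_mul (√(μ i))
    convert! h2 using 1
    ext v
    simp only [ContinuousLinearMap.comp_apply, smul_apply,
      ContinuousLinearMap.id_apply, PiLp.proj_apply, PiLp.zero_apply, mul_zero, add_zero,
      smul_eq_mul]
    have : √(μ i) * √(μ i) = μ i := Real.mul_self_sqrt (hμ i).le
    field_simp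
    rw [pow_two, this, mul_div_cancel_right₀ _ (hμ i).ne']
  have hu0 : u 0 = 0 := by ext i; simp [u, chart_zero]
  have hlo : (fun y => y - u y) =o[𝓝[A] 0] id := by
    have h3 := (hu.hasFDerivAt.isLittleO.mono (nhdsWithin_le_nhds (s := A))).neg_left
    simp only [hu0, sub_zero, ContinuousLinearMap.id_apply, neg_sub] at h3
    exact h3
  refine sub_starProjection_isLittleO_of_mem_inf _ _ (y := id) (u := u) ?_ ?_ hlo
  · filter_upwards [self_mem_nhdsWithin] with y hy
    exact transpose_mulVec_chart_eq_iff.1 hy.2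
  · filter_upwards [self_mem_nhdsWithin] with y hy
    obtain ⟨⟨θ, hθ⟩, -⟩ := hy
    refine ⟨_, ⟨θ - θ₀, rfl⟩, ?_⟩
    congr 1
    ext i
    rw [hθ i, hθ₀ i, Real.log_exp, Real.log_exp, Matrix.mulVecLin_apply, Matrix.mulVec_sub,
      Pi.sub_apply]

/-- `fitSet X L μ` contains points approximating the elements of its tangent space. -/
lemma exists_approx_tangentSpace [Fintype J] (hμ : ∀ i, 0 < μ i) (hmem : μ ∈ fitSet X L μ)
    (hsurj : LinearMap.range (Lᵀ * Matrix.diagonal μ * X).mulVecLin = ⊤) :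
    ∃ g : EuclideanSpace ℝ (Fin k) → EuclideanSpace ℝ (Fin k),
      (∀ᶠ x in 𝓝 0, chart μ (g x) ∈ fitSet X L μ) ∧
      (fun x => g x - (tangentSpace X L μ).starProjection x) =o[𝓝 0] id := by
  obtain ⟨⟨θ₀, hθ₀⟩, -⟩ := hmem
  set W := tangentSpace X L μ
  set T : (Fin t → ℝ) →ₗ[ℝ] (J → ℝ) := (Lᵀ * Matrix.diagonal μ * X).mulVecLin
  set T' : (Fin t → ℝ) →L[ℝ] (J → ℝ) := LinearMap.toContinuousLinearMap T
  let e : (Fin t → ℝ) → Fin k → ℝ := fun θ i => Real.exp ((X *ᵥ θ) i)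
  let X' : (Fin t → ℝ) →L[ℝ] (Fin k → ℝ) := LinearMap.toContinuousLinearMap X.mulVecLin
  have he0 : e θ₀ = μ := funext fun i => (hθ₀ i).symm
  have hei : ∀ i, HasStrictFDerivAt (fun θ => e θ i)
      (μ i • (ContinuousLinearMap.proj i ∘L X')) θ₀ := by
    intro i
    have h1 := ((ContinuousLinearMap.proj i ∘L X' : (Fin t → ℝ) →L[ℝ] ℝ).hasStrictFDerivAt
      (x := θ₀)).exp
    have h2 : Real.exp ((ContinuousLinearMap.proj i ∘L X' : (Fin t → ℝ) →L[ℝ] ℝ) θ₀) = μ i :=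
      (hθ₀ i).symm
    rw [h2] at h1
    exact h1
  have he : HasStrictFDerivAt e
      (ContinuousLinearMap.pi fun i => μ i • (ContinuousLinearMap.proj i ∘L X')) θ₀ :=
    hasStrictFDerivAt_pi.2 hei
  let L' : (Fin k → ℝ) →L[ℝ] (J → ℝ) := LinearMap.toContinuousLinearMap Lᵀ.mulVecLin
  have hF : HasStrictFDerivAt (fun θ => L' (e θ)) T' θ₀ := by
    convert! L'.hasStrictFDerivAt.comp θ₀ he using 1
    ext1 β
    change (Lᵀ * Matrix.diagonal μ * X) *ᵥ β = Lᵀ *ᵥ fun i => μ i • (X *ᵥ β) i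
    rw [← Matrix.mulVec_mulVec, ← Matrix.mulVec_mulVec]
    congr 1
    ext i
    rw [Matrix.mulVec_diagonal, smul_eq_mul]
  have hT' : LinearMap.range (T' : (Fin t → ℝ) →ₗ[ℝ] (J → ℝ)) = ⊤ := hsurj
  -- The implicit function of θ ↦ Lᵀ exp(Xθ): it parametrizes the fibre through θ₀ by the kernel of
  -- the differential, with the inclusion as derivative at 0.
  set ψ : LinearMap.ker (T' : (Fin t → ℝ) →ₗ[ℝ] (J → ℝ)) → (Fin t → ℝ) :=
    hF.implicitFunction _ _ hT' (L' (e θ₀))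
  have hψ : HasStrictFDerivAt ψ (LinearMap.ker (T' : (Fin t → ℝ) →ₗ[ℝ] (J → ℝ))).subtypeL 0 :=
    hF.to_implicitFunction hT'
  have hψ0 : ψ 0 = θ₀ := hF.implicitFunction_apply_image hT'
  have hψF : ∀ᶠ β in 𝓝 0, L' (e (ψ β)) = L' (e θ₀) := by
    have h1 := hF.map_implicitFunction_eq hT'
    have h2 : Tendsto (fun β : LinearMap.ker (T' : (Fin t → ℝ) →ₗ[ℝ] (J → ℝ)) => (L' (e θ₀), β))
        (𝓝 0) (𝓝 (L' (e θ₀), 0)) := (Continuous.prodMk_right _).tendsto _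
    exact h2.eventually h1
  obtain ⟨R, hR⟩ := LinearMap.exists_rightInverse_of_surjective (tangentParam X L hμ)
    (LinearMap.range_eq_top.2 (tangentParam_surjective hμ))
  let β : EuclideanSpace ℝ (Fin k) →L[ℝ] LinearMap.ker (T' : (Fin t → ℝ) →ₗ[ℝ] (J → ℝ)) :=
    (LinearMap.toContinuousLinearMap R) ∘L W.orthogonalProjectionOnto
  have hβ : ∀ x, sqrtMul μ (X *ᵥ (β x).1) = W.starProjection x := fun x => by
    have h1 := LinearMap.congr_fun hR (W.orthogonalProjectionOnto x)
    have h2 := congrArg Subtype.val h1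
    exact h2
  have hψβ : HasStrictFDerivAt (fun x => ψ (β x))
      ((LinearMap.ker (T' : (Fin t → ℝ) →ₗ[ℝ] (J → ℝ))).subtypeL ∘L β) 0 := by
    have h1 : HasStrictFDerivAt ψ (LinearMap.ker (T' : (Fin t → ℝ) →ₗ[ℝ] (J → ℝ))).subtypeL (β 0) := by
      rwa [map_zero]
    exact h1.comp 0 β.hasStrictFDerivAt
  have hψβ0 : ψ (β 0) = θ₀ := by rw [map_zero, hψ0]
  -- `β x` is a kernel vector with √μ · Xβ(x) = P x, obtained from a linear section of
  -- `tangentParam`. Following `ψ` along it gives a map into the model with derivative P at 0.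
  let g : EuclideanSpace ℝ (Fin k) → EuclideanSpace ℝ (Fin k) := fun x =>
    chartInv μ (e (ψ (β x)))
  have hg0 : g 0 = 0 := by
    ext i
    simp only [g, hψβ0, he0]
    simp [chartInv]
  have hg : HasStrictFDerivAt g W.starProjection 0 := by
    rw [hasStrictFDerivAt_euclidean]
    intro i
    have h1 := hei i
    rw [← hψβ0] at h1
    have h2 := ((h1.comp (0 : EuclideanSpace ℝ (Fin k)) hψβ).sub_const (μ i)).mul_const
      ((√(μ i))⁻¹)
    convert! h2 using 1
    ext x
    have h3 : W.starProjection x i = √(μ i) * (X *ᵥ (β x).1) i := by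
      rw [← hβ x, sqrtMul_apply]
    have hs := (Real.sqrt_pos.2 (hμ i)).ne'
    have h4 : (√(μ i))⁻¹ * μ i = √(μ i) := by
      rw [inv_mul_eq_iff_eq_mul₀ hs, Real.mul_self_sqrt (hμ i).le]
    change W.starProjection x i = (√(μ i))⁻¹ * (μ i * (X *ᵥ (β x).1) i)
    rw [h3, ← mul_assoc, h4]
  refine ⟨g, ?_, ?_⟩
  · have hβ0 : Tendsto β (𝓝 0) (𝓝 0) := by simpa using β.continuous.tendsto 0
    filter_upwards [hβ0.eventually hψF] with x hx
    rw [chart_chartInv hμ]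
    refine ⟨⟨ψ (β x), fun i => rfl⟩, ?_⟩
    rw [he0] at hx
    exact hx
  · have := hg.hasFDerivAt.isLittleO
    simp only [hg0, sub_zero] at this
    exact this

end FitSet

/-! ### Passing rank conditions between nested models -/

section RankTransfer

lemma transpose_product {k t : ℕ} {J : Type*} (X : Matrix (Fin k) (Fin t) ℝ)
    (L : Matrix (Fin k) J ℝ) (μ : Fin k → ℝ) :
    (Xᵀ * Matrix.diagonal μ * L)ᵀ = Lᵀ * Matrix.diagonal μ * X := by
  simp [Matrix.transpose_mul, Matrix.mul_assoc]

variable {k t t' : ℕ} {J J' : Type*} [Fintype J] [Fintype J'] {X : Matrix (Fin k) (Fin t) ℝ}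
  {X' : Matrix (Fin k) (Fin t') ℝ} {L : Matrix (Fin k) J ℝ} {L' : Matrix (Fin k) J' ℝ}
  {μ : Fin k → ℝ}

lemma mulVec_injective_of_rank_eq_card {n m : Type*} [Fintype n] [Fintype m] {A : Matrix m n ℝ}
    (h : A.rank = Fintype.card n) : Function.Injective A.mulVecLin := by
  rw [← LinearMap.ker_eq_bot, ← Submodule.finrank_eq_zero (R := ℝ)]
  have := LinearMap.finrank_range_add_finrank_ker A.mulVecLin
  rw [show Module.finrank ℝ (LinearMap.range A.mulVecLin) = _ from h] at this
  simpa using this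

lemma rank_eq_card_of_mulVec_injective {n m : Type*} [Fintype n] [Fintype m] {A : Matrix m n ℝ}
    (h : Function.Injective A.mulVecLin) : A.rank = Fintype.card n := by
  rw [Matrix.rank, LinearMap.finrank_range_of_inj h, Module.finrank_fintype_fun_eq_card]

/-- The kernel of Aᵀ is the orthogonal complement of the range of A, so inclusions are reversed. -/
lemma transpose_mulVec_eq_zero_of_range_le {n n' : Type*} [Fintype n] [Fintype n']
    {A : Matrix (Fin k) n ℝ} {A' : Matrix (Fin k) n' ℝ}
    (hA : LinearMap.range A'.mulVecLin ≤ LinearMap.range A.mulVecLin) {z : Fin k → ℝ}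
    (hz : Aᵀ *ᵥ z = 0) : A'ᵀ *ᵥ z = 0 := by
  refine dotProduct_eq_zero _ fun w => ?_
  obtain ⟨v, hv⟩ := hA ⟨w, rfl⟩
  simp only [Matrix.mulVecLin_apply] at hv
  rw [Matrix.mulVec_transpose, ← Matrix.dotProduct_mulVec, ← hv, Matrix.dotProduct_mulVec,
    ← Matrix.mulVec_transpose, hz, zero_dotProduct]

/-- Regularity of the smaller model implies regularity of the larger one. -/
lemma rank_eq_card_of_nested
    (hX : LinearMap.range X'.mulVecLin ≤ LinearMap.range X.mulVecLin)
    (hL : LinearMap.range L.mulVecLin ≤ LinearMap.range L'.mulVecLin)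
    (hLrank : L.rank = Fintype.card J)
    (hreg : (X'ᵀ * Matrix.diagonal μ * L').rank = Fintype.card J') :
    (Xᵀ * Matrix.diagonal μ * L).rank = Fintype.card J := by
  refine rank_eq_card_of_mulVec_injective (LinearMap.ker_eq_bot.1 (LinearMap.ker_eq_bot'.2 ?_))
  intro v hv
  -- Writing L v = L' w, the equation for the larger model restricts to X'ᵀ diag(μ) L' w = 0.
  -- Regularity of the smaller model gives w = 0, hence L v = 0 and v = 0.
  obtain ⟨w, hw⟩ := hL ⟨v, rfl⟩
  simp only [Matrix.mulVecLin_apply] at hv hw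
  rw [← Matrix.mulVec_mulVec, ← Matrix.mulVec_mulVec] at hv
  have h1 := transpose_mulVec_eq_zero_of_range_le hX hv
  rw [← hw, Matrix.mulVec_mulVec, Matrix.mulVec_mulVec] at h1
  have h2 : w = 0 := mulVec_injective_of_rank_eq_card hreg (h1.trans (map_zero _).symm)
  rw [h2, Matrix.mulVec_zero] at hw
  exact mulVec_injective_of_rank_eq_card hLrank (hw.symm.trans (map_zero _).symm)

lemma range_eq_top_of_rank (hreg : (Xᵀ * Matrix.diagonal μ * L).rank = Fintype.card J) :
    LinearMap.range (Lᵀ * Matrix.diagonal μ * X).mulVecLin = ⊤ := by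
  refine Submodule.eq_top_of_finrank_eq ?_
  rw [← transpose_product, Module.finrank_fintype_fun_eq_card, ← hreg, ← Matrix.rank_transpose]
  rfl

lemma tangentSpace_le_of_nested
    (hX : LinearMap.range X'.mulVecLin ≤ LinearMap.range X.mulVecLin)
    (hL : LinearMap.range L.mulVecLin ≤ LinearMap.range L'.mulVecLin) :
    tangentSpace X' L' μ ≤ tangentSpace X L μ :=
  inf_le_inf (Submodule.map_mono hX) fun y hy => by
    rw [mem_constraintSpace] at hy ⊢
    exact transpose_mulVec_eq_zero_of_range_le hL hy

end RankTransfer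

end LoglinearLC

namespace LoglinearLC

open Asymptotics Topology Complex

/-! ### Independent Poisson tables -/

section PoissonTables

variable {k : ℕ}

lemma integral_cexp_poissonMeasure (r : NNReal) (t : ℝ) :
    ∫ n : ℕ, cexp ((t * n : ℝ) * I) ∂(poissonMeasure r) = cexp (r * (cexp (t * I) - 1)) := by
  rw [← charFun_map_cast_poissonMeasure, charFun_apply, integral_map .of_discrete (by fun_prop)]
  simp [mul_comm]

lemma integral_cexp_pi_poissonMeasure (m : Fin k → ℝ) (hm : ∀ i, 0 < m i) (t : Fin k → ℝ) :
    ∫ n : Fin k → ℕ, cexp ((∑ i, t i * n i : ℝ) * I)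
      ∂(Measure.pi fun i => poissonMeasure (m i).toNNReal)
      = ∏ i, cexp (m i * (cexp (t i * I) - 1)) := by
  have h1 : ∀ n : Fin k → ℕ, cexp ((∑ i, t i * n i : ℝ) * I)
      = ∏ i, cexp ((t i * n i : ℝ) * I) := fun n => by
    rw [← Complex.exp_sum, ← Finset.sum_mul, ofReal_sum]
  simp_rw [h1]
  rw [integral_fintype_prod_eq_prod (f := fun i (n : ℕ) => cexp ((t i * n : ℝ) * I))]
  refine Finset.prod_congr rfl fun i _ => ?_
  rw [integral_cexp_poissonMeasure]
  congr
  exact Real.coe_toNNReal _ (hm i).le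

lemma pi_poissonMeasure_real_singleton (m : Fin k → ℝ) (hm : ∀ i, 0 < m i) (n : Fin k → ℕ) :
    (Measure.pi fun i => poissonMeasure (m i).toNNReal).real {n}
      = (∏ i, Real.exp (-m i)) * ∏ i, m i ^ n i / (n i).factorial := by
  rw [measureReal_def, Measure.pi_singleton, ENNReal.toReal_prod, ← Finset.prod_mul_distrib]
  refine Finset.prod_congr rfl fun i _ => ?_
  rw [← measureReal_def, poissonMeasure_real_singleton, Real.coe_toNNReal _ (hm i).le]
  ring

end PoissonTables

/-! ### Tables with given totals and the multinomial theorem -/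

section Multinomial

variable {k c : ℕ}

/-- The tables whose subtables have the totals `τ`. -/
def tablesWithTotals (sub : Fin k → Fin c) (τ : Fin c → ℕ) : Finset (Fin k → ℕ) :=
  (Fintype.piFinset fun i => Finset.range (τ (sub i) + 1)).filter
    fun n => ∀ h, ∑ i with sub i = h, n i = τ h

/-- The box in the definition only provides finiteness: an entry never exceeds the total of its
subtable. -/
lemma mem_tablesWithTotals {sub : Fin k → Fin c} {τ : Fin c → ℕ} {n : Fin k → ℕ} :
    n ∈ tablesWithTotals sub τ ↔ ∀ h, ∑ i with sub i = h, n i = τ h := by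
  simp only [tablesWithTotals, Finset.mem_filter, Fintype.mem_piFinset, Finset.mem_range,
    and_iff_right_iff_imp]
  intro h i
  rw [Nat.lt_succ_iff, ← h (sub i)]
  exact Finset.single_le_sum (f := n) (fun _ _ => Nat.zero_le _) (by simp)

lemma pow_sum_div_factorial {ι : Type*} [DecidableEq ι] (s : Finset ι) (z : ι → ℂ) (N : ℕ) :
    (∑ i ∈ s, z i) ^ N / N.factorial
      = ∑ p ∈ s.piAntidiag N, ∏ i ∈ s, z i ^ p i / (p i).factorial := by
  rw [Finset.sum_pow_eq_sum_piAntidiag, Finset.sum_div]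
  refine Finset.sum_congr rfl fun p hp => ?_
  have h1 := Nat.multinomial_spec s p
  rw [(Finset.mem_piAntidiag.1 hp).1] at h1
  have h2 : (∏ i ∈ s, ((p i).factorial : ℂ)) ≠ 0 :=
    Finset.prod_ne_zero_iff.2 fun i _ => Nat.cast_ne_zero.2 (Nat.factorial_ne_zero _)
  rw [Finset.prod_div_distrib, ← h1, div_eq_div_iff
    (Nat.cast_ne_zero.2 (h1 ▸ Nat.factorial_ne_zero _)) h2]
  push_cast
  ring

/-- The multinomial theorem, for a product of subtables. -/
lemma sum_tablesWithTotals (sub : Fin k → Fin c) (τ : Fin c → ℕ) (z : Fin k → ℂ) :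
    ∑ n ∈ tablesWithTotals sub τ, ∏ i, z i ^ n i / (n i).factorial
      = ∏ h, (∑ i with sub i = h, z i) ^ τ h / (τ h).factorial := by
  simp_rw [pow_sum_div_factorial]
  rw [Finset.prod_univ_sum]
  -- A table corresponds to the family of its restrictions to the subtables, each extended by zero.
  refine Finset.sum_bij' (fun n _ h i => if sub i = h then n i else 0) (fun p _ i => p (sub i) i)
    ?_ ?_ ?_ ?_ ?_
  · intro n hn
    rw [mem_tablesWithTotals] at hn
    refine Fintype.mem_piFinset.2 fun h => Finset.mem_piAntidiag.2 ⟨?_, fun i hi => ?_⟩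
    · rw [← hn h]
      exact Finset.sum_congr rfl fun i hi => if_pos (Finset.mem_filter.1 hi).2
    · by_contra hne
      simp only [Finset.mem_filter, Finset.mem_univ, true_and] at hne
      exact hi (if_neg hne)
  · intro p hp
    refine mem_tablesWithTotals.2 fun h => ?_
    rw [← (Finset.mem_piAntidiag.1 (Fintype.mem_piFinset.1 hp h)).1]
    exact Finset.sum_congr rfl fun i hi => by rw [(Finset.mem_filter.1 hi).2]
  · intro n _
    ext i
    simp
  · intro p hp
    ext h i
    by_cases hi : sub i = h
    · simp [hi]
    · have := mt ((Finset.mem_piAntidiag.1 (Fintype.mem_piFinset.1 hp h)).2 i) (by simp [hi])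
      simp only [ne_eq, not_not] at this
      simp [hi, this]
  · intro n _
    rw [← Finset.prod_fiberwise (g := sub)]
    refine Finset.prod_congr rfl fun h _ => Finset.prod_congr rfl fun i hi => ?_
    simp only [(Finset.mem_filter.1 hi).2, if_true]

lemma integral_cond_finset {α : Type*} [MeasurableSpace α] [MeasurableSingletonClass α]
    (μ : Measure α) [IsFiniteMeasure μ] (s : Finset α) (f : α → ℂ) :
    ∫ x, f x ∂(ProbabilityTheory.cond μ (s : Set α))
      = (∑ x ∈ s, (μ.real {x} : ℂ) * f x) / ∑ x ∈ s, (μ.real {x} : ℂ) := by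
  rw [ProbabilityTheory.cond, integral_smul_measure, ENNReal.toReal_inv, ← measureReal_def,
    setIntegral_finset _ IntegrableOn.finset, ← sum_measureReal_singleton, div_eq_inv_mul,
    ← ofReal_sum, real_smul, ofReal_inv]
  simp only [real_smul]

end Multinomial

end LoglinearLC

namespace LoglinearLC

open Asymptotics Topology Complex

/-! ### Characteristic function of the table -/

section TableLaw

variable {k c : ℕ}

lemma totals_productMultinomial (hc : 1 ≤ c) (sub : Fin k → Fin c)
    (hs : Function.Surjective sub) (v : Fin k → ℝ) (h : Fin c) :
    (SamplingPlan.productMultinomial c hc sub hs).totals v h = ∑ i with sub i = h, v i := by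
  rw [Finset.sum_filter]
  change ∑ i, (if sub i = h then (1 : ℝ) else 0) * v i = _
  exact Finset.sum_congr rfl fun i _ => by split_ifs <;> simp

lemma integral_cexp_tableLaw_poisson (m : Fin k → ℝ) (hm : ∀ i, 0 < m i)
    (τ : Fin (SamplingPlan.poisson : SamplingPlan k).c → ℕ) (t : Fin k → ℝ) :
    ∫ n, cexp ((∑ i, t i * n i : ℝ) * I) ∂(SamplingPlan.poisson.tableLaw m τ)
      = ∏ i, cexp (m i * (cexp (t i * I) - 1)) := by
  rw [SamplingPlan.tableLaw]
  have : {n : Fin k → ℕ | (SamplingPlan.poisson : SamplingPlan k).totals (realCounts n)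
      = fun h => (τ h : ℝ)} = Set.univ := by
    ext n
    simp only [Set.mem_ofPred_eq, Set.mem_univ, iff_true]
    ext h
    exact Fin.elim0 h
  rw [this, ProbabilityTheory.cond_univ, integral_cexp_pi_poissonMeasure m hm]

/-- Numerator and normalizing constant are both sums of Poisson weights over the tables with totals
`τ`, the former with m_i replaced by m_i exp(i t_i). The multinomial theorem evaluates both; the
exponential constant and the factorials cancel. -/
lemma integral_cexp_tableLaw_productMultinomial (hc : 1 ≤ c) (sub : Fin k → Fin c)
    (hs : Function.Surjective sub) (m : Fin k → ℝ) (hm : ∀ i, 0 < m i) (τ : Fin c → ℕ)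
    (t : Fin k → ℝ) :
    ∫ n, cexp ((∑ i, t i * n i : ℝ) * I)
      ∂((SamplingPlan.productMultinomial c hc sub hs).tableLaw m τ)
      = ∏ h, ((∑ i with sub i = h, m i * cexp (t i * I)) / ∑ i with sub i = h, (m i : ℂ)) ^ τ h := by
  have hset : {n : Fin k → ℕ | (SamplingPlan.productMultinomial c hc sub hs).totals (realCounts n)
      = fun h => (τ h : ℝ)} = (tablesWithTotals sub τ : Set (Fin k → ℕ)) := by
    ext n
    refine Iff.trans funext_iff (Iff.trans (forall_congr' fun h => ?_) mem_tablesWithTotals.symm)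
    have h1 := totals_productMultinomial hc sub hs (realCounts n) h
    simp only [realCounts] at h1
    change (SamplingPlan.productMultinomial c hc sub hs).totals (realCounts n) h = (τ h : ℝ) ↔ _
    rw [show (SamplingPlan.productMultinomial c hc sub hs).totals (realCounts n) h = _ from h1]
    exact_mod_cast Iff.rfl
  have hlaw : (SamplingPlan.productMultinomial c hc sub hs).tableLaw m τ
      = ProbabilityTheory.cond (Measure.pi fun i => poissonMeasure (m i).toNNReal)
        (tablesWithTotals sub τ : Set (Fin k → ℕ)) := by
    rw [← hset]
    rfl
  set C : ℂ := ((∏ i, Real.exp (-m i) : ℝ) : ℂ)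
  have hC : C ≠ 0 := ofReal_ne_zero.2 (Finset.prod_ne_zero_iff.2 fun i _ => (Real.exp_pos _).ne')
  have hreal : ∀ n : Fin k → ℕ, ((Measure.pi fun i => poissonMeasure (m i).toNNReal).real {n} : ℂ)
      = C * ∏ i, (m i : ℂ) ^ n i / (n i).factorial := fun n => by
    rw [pi_poissonMeasure_real_singleton m hm]
    simp only [C]
    push_cast
    rfl
  have hreal' : ∀ n : Fin k → ℕ, ((Measure.pi fun i => poissonMeasure (m i).toNNReal).real {n} : ℂ)
      * cexp ((∑ i, t i * n i : ℝ) * I)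
      = C * ∏ i, (m i * cexp (t i * I)) ^ n i / (n i).factorial := fun n => by
    rw [hreal, mul_assoc, ofReal_sum, Finset.sum_mul, Complex.exp_sum, ← Finset.prod_mul_distrib]
    congr 1
    refine Finset.prod_congr rfl fun i _ => ?_
    rw [mul_pow, ← Complex.exp_nat_mul]
    push_cast
    rw [show (t i : ℂ) * n i * I = n i * (t i * I) by ring]
    ring
  rw [hlaw, integral_cond_finset]
  simp_rw [hreal', hreal]
  rw [← Finset.mul_sum, ← Finset.mul_sum, sum_tablesWithTotals, sum_tablesWithTotals,
    mul_div_mul_left _ _ hC, ← Finset.prod_div_distrib]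
  refine Finset.prod_congr rfl fun h _ => ?_
  rw [div_div_div_cancel_right₀ (Nat.cast_ne_zero.2 (Nat.factorial_ne_zero _)), div_pow]

end TableLaw

/-! ### Two limits for complex exponentials -/

section Limits

variable {l : Filter ℕ}

/-- Taylor expansion at z = i t / √N: N z² / 2 is exactly -t² / 2, and the remainder is at most N
|z|³ = |t|³ / √N. -/
lemma tendsto_mul_cexp_sub {N : ℕ → ℝ} (hN : Tendsto N l atTop) (t : ℝ) :
    Tendsto (fun ν => (N ν : ℂ) * (cexp ((t / √(N ν) : ℝ) * I) - 1 - (t / √(N ν) : ℝ) * I)) l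
      (𝓝 (-(t ^ 2 / 2 : ℝ))) := by
  have hsq : Tendsto (fun ν => √(N ν)) l atTop := Real.tendsto_sqrt_atTop.comp hN
  have hz : Tendsto (fun ν => |t| / √(N ν)) l (𝓝 0) := tendsto_const_nhds.div_atTop hsq
  have hb : Tendsto (fun ν => |t| ^ 3 / √(N ν)) l (𝓝 0) := tendsto_const_nhds.div_atTop hsq
  rw [tendsto_iff_norm_sub_tendsto_zero]
  refine squeeze_zero' (.of_forall fun ν => norm_nonneg _) ?_ hb
  filter_upwards [hN.eventually_gt_atTop 0, hz.eventually_le_const one_pos] with ν hν hzν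
  have hs : 0 < √(N ν) := Real.sqrt_pos.2 hν
  set z : ℂ := (t / √(N ν) : ℝ) * I
  have hzn : ‖z‖ = |t| / √(N ν) := by
    simp only [z, norm_mul, norm_real, Complex.norm_I, mul_one, Real.norm_eq_abs, abs_div,
      abs_of_pos hs]
  have hz2 : (N ν : ℂ) * (z ^ 2 / 2) = -(t ^ 2 / 2 : ℝ) := by
    simp only [z, mul_pow, I_sq]
    norm_cast
    rw [div_pow, Real.sq_sqrt hν.le]
    push_cast
    have : (N ν : ℂ) ≠ 0 := ofReal_ne_zero.2 hν.ne'
    field_simp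
  have hexp := Complex.exp_bound (x := z) (by rw [hzn]; exact hzν) (n := 3) (by norm_num)
  simp only [Finset.sum_range_succ, Finset.sum_range_zero, Nat.factorial] at hexp
  rw [← hz2, ← mul_sub, norm_mul, norm_real, Real.norm_of_nonneg hν.le]
  have h1 : ‖cexp z - 1 - z - z ^ 2 / 2‖ ≤ ‖z‖ ^ 3 := by
    refine le_trans (le_of_eq ?_) (hexp.trans ?_)
    · congr 1
      push_cast
      ring
    · norm_num
      have := pow_nonneg (norm_nonneg z) 3
      linarith
  calc N ν * ‖cexp z - 1 - z - z ^ 2 / 2‖ ≤ N ν * ‖z‖ ^ 3 := by gcongr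
    _ = |t| ^ 3 / √(N ν) := by
      rw [hzn, div_pow]
      nth_rewrite 1 [← Real.sq_sqrt hν.le]
      field_simp

/-- The power is exp(a log(1 + z)) with log(1 + z) = z + O(z²). Since a z converges and a → ∞, z → 0
and a z² = (a z) z → 0. -/
lemma tendsto_one_add_pow_cexp {a : ℕ → ℕ} {z : ℕ → ℂ} {w : ℂ} (ha : Tendsto a l atTop)
    (h : Tendsto (fun ν => (a ν : ℂ) * z ν) l (𝓝 w)) :
    Tendsto (fun ν => (1 + z ν) ^ a ν) l (𝓝 (cexp w)) := by
  have hz : Tendsto z l (𝓝 0) := by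
    have h1 : Tendsto (fun ν => ((a ν : ℂ))⁻¹) l (𝓝 0) :=
      (tendsto_inv_atTop_nhds_zero_nat (𝕜 := ℂ)).comp ha
    have h2 := h1.mul h
    rw [zero_mul] at h2
    refine h2.congr' ?_
    filter_upwards [ha.eventually_ne_atTop 0] with ν hν
    rw [inv_mul_cancel_left₀ (Nat.cast_ne_zero.2 hν)]
  have hlog : Tendsto (fun ν => (a ν : ℂ) * log (1 + z ν)) l (𝓝 w) := by
    have h1 : (fun ν => (a ν : ℂ) * (log (1 + z ν) - z ν)) =o[l] fun _ => (1 : ℂ) := by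
      have h2 := (log_sub_self_isBigO.comp_tendsto hz)
      have h3 := (isBigO_refl (fun ν => (a ν : ℂ)) l).mul h2
      refine h3.trans_isLittleO ?_
      have h4 := h.mul hz
      rw [mul_zero] at h4
      refine ((isLittleO_one_iff ℂ).2 h4).congr_left fun ν => ?_
      simp only [Function.comp_apply]
      ring
    have h5 := ((isLittleO_one_iff ℂ).1 h1).add h
    rw [zero_add] at h5
    exact h5.congr fun ν => by ring
  refine ((continuous_exp.tendsto _).comp hlog).congr' ?_
  have : ∀ᶠ ν in l, 1 + z ν ≠ 0 := by
    have h1 : Tendsto (fun ν => 1 + z ν) l (𝓝 (1 + 0)) := tendsto_const_nhds.add hz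
    exact h1.eventually_ne (by simp)
  filter_upwards [this] with ν hν
  rw [Function.comp_apply, Complex.exp_nat_mul, exp_log hν]

end Limits

/-! ### Central limit theorem for the table -/

section CentralLimit

variable {k : ℕ}

/-- Convergence of the characteristic function of the normalized table, at arguments which are
orthogonal to the subtable totals. -/
theorem tendsto_integral_cexp_tableLaw (S : SamplingPlan k) {μ : Fin k → ℝ} (hμ : ∀ i, 0 < μ i)
    {N : ℕ → ℝ} (hN0 : ∀ ν, 0 < N ν) (hN : Tendsto N atTop atTop) {τ : ℕ → Fin S.c → ℕ}
    (hτ : ∀ ν, S.totals (N ν • μ) = fun h => (τ ν h : ℝ)) {t : Fin k → ℝ}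
    (ht : S.totals (fun i => μ i * t i) = 0) :
    Tendsto (fun ν => ∫ n, cexp ((∑ i, t i * ((n i - N ν * μ i) / √(N ν)) : ℝ) * I)
        ∂(S.tableLaw (N ν • μ) (τ ν))) atTop
      (𝓝 (cexp (-((∑ i, μ i * t i ^ 2) / 2 : ℝ)))) := by
  have hm : ∀ ν i, 0 < (N ν • μ) i := fun ν i => mul_pos (hN0 ν) (hμ i)
  have hsplit : ∀ ν (n : Fin k → ℕ), cexp ((∑ i, t i * ((n i - N ν * μ i) / √(N ν)) : ℝ) * I)
      = cexp (-(∑ i, t i / √(N ν) * (N ν * μ i) : ℝ) * I)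
        * cexp ((∑ i, t i / √(N ν) * n i : ℝ) * I) := fun ν n => by
    rw [← Complex.exp_add, ← add_mul]
    congr 2
    rw [← ofReal_neg, ← ofReal_add, ← Finset.sum_neg_distrib, ← Finset.sum_add_distrib]
    congr 1
    exact Finset.sum_congr rfl fun i _ => by ring
  simp_rw [hsplit, integral_const_mul]
  have hE := fun i => (tendsto_mul_cexp_sub hN (t i)).const_mul (μ i : ℂ)
  cases S with
  | poisson =>
    simp_rw [fun ν => integral_cexp_tableLaw_poisson (N ν • μ) (hm ν) (τ ν)]
    -- For Poisson sampling the centring phase supplies exactly the linear terms subtracted in `hE`.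
    have h1 := (tendsto_finsetProd Finset.univ fun i _ =>
      (continuous_exp.tendsto _).comp (hE i))
    convert! h1 using 2 with ν
    · simp only [Function.comp_apply]
      rw [← Complex.exp_sum, ← Complex.exp_add, ← Complex.exp_sum, ofReal_sum,
        ← Finset.sum_neg_distrib, Finset.sum_mul, ← Finset.sum_add_distrib]
      congr 1
      refine Finset.sum_congr rfl fun i _ => ?_
      simp only [Pi.smul_apply, smul_eq_mul]
      push_cast
      ring
    · rw [← Complex.exp_sum]
      congr 1
      push_cast
      rw [Finset.sum_div, ← Finset.sum_neg_distrib]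
      exact Finset.sum_congr rfl fun i _ => by ring
  | productMultinomial c hc sub hs =>
    have ht' : ∀ h, ∑ i with sub i = h, μ i * t i = 0 := fun h => by
      rw [← totals_productMultinomial hc sub hs (fun i => μ i * t i) h, ht]
      rfl
    have hτ' : ∀ ν h, N ν * ∑ i with sub i = h, μ i = τ ν h := fun ν h => by
      have := congrFun (hτ ν) h
      rw [totals_productMultinomial] at this
      rw [← this, Finset.mul_sum]
      rfl
    have hs0 : ∀ h, 0 < ∑ i with sub i = h, μ i := fun h => by
      obtain ⟨i, hi⟩ := hs h
      exact Finset.sum_pos (fun i _ => hμ i) ⟨i, by simp [hi]⟩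
    simp_rw [fun ν => integral_cexp_tableLaw_productMultinomial hc sub hs (N ν • μ) (hm ν) (τ ν)]
    have hfactor : ∀ h : Fin c, Tendsto (fun ν => ((∑ i with sub i = h,
        ((N ν • μ) i : ℂ) * cexp ((t i / √(N ν) : ℝ) * I)) /
        ∑ i with sub i = h, ((N ν • μ) i : ℂ)) ^ τ ν h) atTop
        (𝓝 (cexp (∑ i with sub i = h, (μ i : ℂ) * (-(t i ^ 2 / 2 : ℝ))))) := by
      intro h
      have hsC : (∑ i with sub i = h, (μ i : ℂ)) ≠ 0 := by
        rw [← ofReal_sum]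
        exact ofReal_ne_zero.2 (hs0 h).ne'
      have ha : Tendsto (fun ν => τ ν h) atTop atTop := by
        rw [← tendsto_natCast_atTop_iff (R := ℝ)]
        simp_rw [← hτ']
        exact hN.atTop_mul_const (hs0 h)
      -- Here the linear terms may be subtracted for free: in each subtable ∑ μ_i t_i = 0. For the
      -- same reason the centring phase vanishes below.
      have hz := tendsto_one_add_pow_cexp (l := atTop) (a := fun ν => τ ν h)
        (z := fun ν => (∑ i with sub i = h, (μ i : ℂ) * (cexp ((t i / √(N ν) : ℝ) * I) - 1)) /
          ∑ i with sub i = h, (μ i : ℂ))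
        (w := ∑ i with sub i = h, (μ i : ℂ) * (-(t i ^ 2 / 2 : ℝ))) ha (by
          refine (tendsto_finsetSum (Finset.univ.filter fun i => sub i = h)
            fun i _ => hE i).congr fun ν => ?_
          have h1 : ((τ ν h : ℕ) : ℂ) = N ν * ∑ i with sub i = h, (μ i : ℂ) := by
            rw [← ofReal_natCast, ← hτ' ν h]
            push_cast
            rfl
          have h2 : ∑ i with sub i = h, (μ i : ℂ) * t i = 0 := by
            have := congrArg ((↑) : ℝ → ℂ) (ht' h)
            push_cast at this
            exact this
          have h3 : ∑ i with sub i = h, (μ i : ℂ) * (N ν * (cexp ((t i / √(N ν) : ℝ) * I) - 1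
              - (t i / √(N ν) : ℝ) * I))
              = N ν * (∑ i with sub i = h, (μ i : ℂ) * (cexp ((t i / √(N ν) : ℝ) * I) - 1))
                - N ν * I / (√(N ν) : ℝ) * ∑ i with sub i = h, (μ i : ℂ) * t i := by
            rw [Finset.mul_sum, Finset.mul_sum, ← Finset.sum_sub_distrib]
            refine Finset.sum_congr rfl fun i _ => ?_
            push_cast
            ring
          rw [h3, h2, h1]
          rw [mul_zero, sub_zero, mul_assoc, mul_div_cancel₀ _ hsC])
      refine hz.congr fun ν => ?_
      have hNν : (N ν : ℂ) ≠ 0 := ofReal_ne_zero.2 (hN0 ν).ne'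
      congr 1
      simp only [Pi.smul_apply, smul_eq_mul, ofReal_mul, mul_assoc, ← Finset.mul_sum]
      rw [mul_div_mul_left _ _ hNν, eq_div_iff hsC, add_mul, div_mul_cancel₀ _ hsC, one_mul,
        ← Finset.sum_add_distrib]
      exact Finset.sum_congr rfl fun i _ => by ring
    have h1 := tendsto_finsetProd Finset.univ fun h _ => hfactor h
    have h0 : ∀ ν, (∑ i, t i / √(N ν) * (N ν * μ i) : ℝ) = 0 := fun ν => by
      have h2 : ∑ i, μ i * t i = 0 := by
        rw [← Finset.sum_fiberwise (g := sub)]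
        exact Finset.sum_eq_zero fun h _ => ht' h
      have h3 : ∑ i, t i / √(N ν) * (N ν * μ i) = N ν / √(N ν) * ∑ i, μ i * t i := by
        rw [Finset.mul_sum]
        exact Finset.sum_congr rfl fun i _ => by ring
      rw [h3, h2, mul_zero]
    simp_rw [h0]
    simp only [ofReal_zero, neg_zero, zero_mul, Complex.exp_zero, one_mul]
    convert! h1 using 2
    rw [← Complex.exp_sum, Finset.sum_fiberwise]
    congr 1
    push_cast
    rw [Finset.sum_div, ← Finset.sum_neg_distrib]
    exact Finset.sum_congr rfl fun i _ => by ring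

end CentralLimit

end LoglinearLC

namespace LoglinearLC

open Asymptotics Topology Complex

/-! ### Squared norm of a standard Gaussian -/

section ChiSquared

variable {E : Type*} [NormedAddCommGroup E] [InnerProductSpace ℝ E] [FiniteDimensional ℝ E]
  [MeasurableSpace E] [BorelSpace E]

lemma map_norm_sq_stdGaussian :
    (stdGaussian E).map (fun z => ‖z‖ ^ 2) = chiSquared (Module.finrank ℝ E) := by
  rw [stdGaussian, chiSquared, Measure.map_map (by fun_prop) (by fun_prop)]
  congr 1
  ext z
  set b := stdOrthonormalBasis ℝ E
  have h := b.repr.norm_map (∑ i, z i • b i)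
  rw [Function.comp_apply, ← h, EuclideanSpace.norm_sq_eq]
  refine Finset.sum_congr rfl fun i _ => ?_
  rw [b.repr_apply_apply, inner_sum, Real.norm_eq_abs, sq_abs]
  simp [inner_smul_right, b.inner_eq_ite]

end ChiSquared

/-! ### From the central limit theorem to the chi-squared limit -/

section NormalizedTable

variable {k : ℕ}

/-- The table `n / N` in the chart around `μ`. -/
noncomputable def normTable (μ : Fin k → ℝ) (N : ℝ) (n : Fin k → ℕ) : EuclideanSpace ℝ (Fin k) :=
  chartInv μ (N⁻¹ • realCounts n)

lemma normTable_mem_constraintSpace {S : SamplingPlan k} {μ : Fin k → ℝ} (hμ : ∀ i, 0 < μ i)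
    {N : ℝ} (hN : 0 < N) {n : Fin k → ℕ} (hn : S.totals (realCounts n) = S.totals (N • μ)) :
    normTable μ N n ∈ constraintSpace S.X0 μ := by
  rw [← transpose_mulVec_chart_eq_iff, normTable, chart_chartInv hμ, Matrix.mulVec_smul]
  simp only [SamplingPlan.totals, Matrix.mulVec_smul] at hn
  rw [hn, inv_smul_smul₀ hN.ne']

lemma inner_smul_normTable {μ : Fin k → ℝ} {N : ℝ} (hN : 0 < N) (n : Fin k → ℕ)
    (q : EuclideanSpace ℝ (Fin k)) :
    inner ℝ (√N • normTable μ N n) q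
      = ∑ i, q i / √(μ i) * ((n i - N * μ i) / √N) := by
  rw [inner_smul_left, PiLp.inner_apply, Finset.mul_sum]
  refine Finset.sum_congr rfl fun i _ => ?_
  have h1 := (Real.sqrt_pos.2 hN).ne'
  have h2 : √N * (N⁻¹ * n i - μ i) = (n i - N * μ i) / √N := by
    rw [eq_div_iff h1, mul_right_comm, Real.mul_self_sqrt hN.le]
    field_simp
  have h3 : (inner ℝ (normTable μ N n i) (q i) : ℝ) = q i * ((N⁻¹ * n i - μ i) / √(μ i)) := by
    simp [normTable, chartInv, realCounts]
  rw [h3, ← h2]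
  simp only [conj_trivial]
  ring

variable {S : SamplingPlan k} {μ : Fin k → ℝ} {N : ℕ → ℝ} {τ : ℕ → Fin S.c → ℕ}

/-- Pairing with `q` is the linear statistic with coefficients t_i = q_i / √μ_i. Membership in the
constraint space is the orthogonality required by the central limit theorem, and the variance ∑ μ_i
t_i² is ‖q‖². -/
lemma tendsto_charFun_normTable (hμ : ∀ i, 0 < μ i) (hN0 : ∀ ν, 0 < N ν)
    (hN : Tendsto N atTop atTop) (hτ : ∀ ν, S.totals (N ν • μ) = fun h => (τ ν h : ℝ))
    {Q : Submodule ℝ (EuclideanSpace ℝ (Fin k))} (hQ : Q ≤ constraintSpace S.X0 μ) (q : Q) :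
    Tendsto (fun ν => charFun ((S.tableLaw (N ν • μ) (τ ν)).map
      fun n => Q.orthogonalProjectionOnto (√(N ν) • normTable μ (N ν) n)) q) atTop
      (𝓝 (charFun (stdGaussian Q) q)) := by
  have ht : S.totals (fun i => μ i * ((q : EuclideanSpace ℝ (Fin k)) i / √(μ i))) = 0 := by
    have h1 := mem_constraintSpace.1 (hQ q.2)
    rw [SamplingPlan.totals, ← h1]
    congr 1
    ext i
    have := (Real.sqrt_pos.2 (hμ i)).ne'
    nth_rewrite 1 [← Real.sq_sqrt (hμ i).le]
    field_simp
  have h := tendsto_integral_cexp_tableLaw S hμ hN0 hN hτ ht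
  have hlim : -((∑ i, μ i * ((q : EuclideanSpace ℝ (Fin k)) i / √(μ i)) ^ 2) / 2)
      = -‖q‖ ^ 2 / 2 := by
    rw [neg_div, Submodule.coe_norm, EuclideanSpace.norm_sq_eq]
    congr 2
    refine Finset.sum_congr rfl fun i _ => ?_
    rw [div_pow, Real.sq_sqrt (hμ i).le, mul_div_cancel₀ _ (hμ i).ne', Real.norm_eq_abs, sq_abs]
  have hlim' : cexp (-((∑ i, μ i * ((q : EuclideanSpace ℝ (Fin k)) i / √(μ i)) ^ 2) / 2 : ℝ))
      = charFun (stdGaussian Q) q := by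
    rw [charFun_stdGaussian, ← ofReal_neg, hlim]
    push_cast
    rfl
  rw [← hlim']
  refine h.congr fun ν => ?_
  rw [charFun_apply, integral_map Measurable.of_discrete.aemeasurable (by fun_prop)]
  refine integral_congr_ae (.of_forall fun n => ?_)
  simp only
  rw [← inner_smul_normTable (hN0 ν) n q]
  congr 3
  rw [Submodule.coe_inner, ← Submodule.starProjection_apply,
    Submodule.inner_starProjection_left_eq_right, Submodule.starProjection_eq_self_iff.2 q.2]

/-- Tightness of the normalized tables. -/
lemma exists_measure_norm_normTable_le (hμ : ∀ i, 0 < μ i) (hN0 : ∀ ν, 0 < N ν)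
    (hN : Tendsto N atTop atTop) (hτ : ∀ ν, S.totals (N ν • μ) = fun h => (τ ν h : ℝ))
    [∀ ν, IsProbabilityMeasure (S.tableLaw (N ν • μ) (τ ν))] {p : ENNReal} (hp : 0 < p) :
    ∃ C : ℝ, 0 < C ∧ ∀ ν, S.tableLaw (N ν • μ) (τ ν)
      {n | S.totals (realCounts n) = (fun h => (τ ν h : ℝ)) ∧
        C < ‖√(N ν) • normTable μ (N ν) n‖} ≤ p := by
  -- Tightness is needed for the full norm, hence the projection onto the whole constraint space,
  -- which fixes normalized tables with the right totals. It follows from convergence of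
  -- characteristic functions to a continuous limit.
  set K := constraintSpace S.X0 μ
  set law : ℕ → Measure K := fun ν => (S.tableLaw (N ν • μ) (τ ν)).map
      fun n => K.orthogonalProjectionOnto (√(N ν) • normTable μ (N ν) n)
  have hprob : ∀ ν, IsProbabilityMeasure (law ν) := fun ν =>
    Measure.isProbabilityMeasure_map Measurable.of_discrete.aemeasurable
  have htight : IsTightMeasureSet (Set.range law) :=
    isTightMeasureSet_of_tendsto_charFun (f := charFun (stdGaussian K))
      (by fun_prop) (tendsto_charFun_normTable hμ hN0 hN hτ le_rfl)
  have h1 := tendsto_measure_norm_gt_of_isTightMeasureSet htight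
  obtain ⟨C, hC, hC0⟩ := ((h1.eventually_lt_const hp).and (eventually_gt_atTop 0)).exists
  refine ⟨C, hC0, fun ν => ?_⟩
  have h2 : law ν {x | C < ‖x‖} ≤ p :=
    (le_iSup₂ (f := fun (m : Measure K) (_ : m ∈ Set.range law) => m {x | C < ‖x‖})
      (law ν) ⟨ν, rfl⟩).trans hC.le
  rw [Measure.map_apply Measurable.of_discrete (measurableSet_lt (by fun_prop) (by fun_prop))] at h2
  refine (measure_mono ?_).trans h2
  rintro n ⟨hn, hnC⟩
  have hmem : √(N ν) • normTable μ (N ν) n ∈ K :=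
    K.smul_mem _ (normTable_mem_constraintSpace hμ (hN0 ν) (hn.trans (hτ ν).symm))
  change C < ‖K.orthogonalProjectionOnto (√(N ν) • normTable μ (N ν) n)‖
  rw [Submodule.coe_norm, ← Submodule.starProjection_apply,
    Submodule.starProjection_eq_self_iff.2 hmem]
  exact hnC

lemma ae_tableLaw_totals (m : Fin k → ℝ) (s : Fin S.c → ℕ) :
    ∀ᵐ n ∂(S.tableLaw m s), S.totals (realCounts n) = fun h => (s h : ℝ) := by
  rw [SamplingPlan.tableLaw, ProbabilityTheory.cond]
  refine Measure.ae_smul_measure ?_ _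
  exact ae_restrict_mem (Set.to_countable _).measurableSet

/-- A statistic which is, to second order, the squared norm of the projection of the normalized
table onto `Q`, is asymptotically chi-squared. -/
theorem tendstoInDistribution_chiSquared (hμ : ∀ i, 0 < μ i) (hN0 : ∀ ν, 0 < N ν)
    (hN : Tendsto N atTop atTop) (hτ : ∀ ν, S.totals (N ν • μ) = fun h => (τ ν h : ℝ))
    {Q : Submodule ℝ (EuclideanSpace ℝ (Fin k))} (hQ : Q ≤ constraintSpace S.X0 μ)
    {T : ℕ → (Fin k → ℕ) → ℝ}
    (hT : ∀ ε > 0, ∃ δ > 0, ∀ ν n, S.totals (realCounts n) = (fun h => (τ ν h : ℝ)) →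
      ‖normTable μ (N ν) n‖ < δ →
      |T ν n - N ν * ‖Q.starProjection (normTable μ (N ν) n)‖ ^ 2|
        ≤ ε * (N ν * ‖normTable μ (N ν) n‖ ^ 2))
    {Ω : ℕ → Type*} [∀ ν, MeasurableSpace (Ω ν)] (P : ∀ ν, Measure (Ω ν))
    [∀ ν, IsProbabilityMeasure (P ν)] (n : ∀ ν, Ω ν → Fin k → ℕ)
    (hn : ∀ ν, HasLaw (n ν) (S.tableLaw (N ν • μ) (τ ν)) (P ν)) :
    TendstoInDistribution (fun ν ω => T ν (n ν ω)) atTop id P (chiSquared (Module.finrank ℝ Q)) := by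
  have hprob : ∀ ν, IsProbabilityMeasure (S.tableLaw (N ν • μ) (τ ν)) := fun ν =>
    (hn ν).isProbabilityMeasure_iff.1 inferInstance
  set law := fun ν => S.tableLaw (N ν • μ) (τ ν)
  -- all the tables are realized on a common probability space
  set R : Measure (ℕ → Fin k → ℕ) := Measure.infinitePi law
  have hev : ∀ ν, MeasurePreserving (fun ω : ℕ → Fin k → ℕ => ω ν) R (law ν) := fun ν =>
    measurePreserving_eval_infinitePi law ν
  have hZ : TendstoInDistribution (fun ν (ω : ℕ → Fin k → ℕ) =>
      Q.orthogonalProjectionOnto (√(N ν) • normTable μ (N ν) (ω ν))) atTop id (fun _ => R)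
      (stdGaussian Q) := by
    have hmeas : ∀ ν, Measurable fun n : Fin k → ℕ =>
      Q.orthogonalProjectionOnto (√(N ν) • normTable μ (N ν) n) := fun ν => .of_discrete
    refine ⟨fun ν => ((hmeas ν).comp (hev ν).measurable).aemeasurable, aemeasurable_id, ?_⟩
    refine ProbabilityMeasure.tendsto_iff_tendsto_charFun.2 fun q => ?_
    have h := tendsto_charFun_normTable hμ hN0 hN hτ hQ q
    simp only [ProbabilityMeasure.coe_mk, Measure.map_id]
    refine h.congr fun ν => ?_
    change charFun (Measure.map _ (law ν)) q = _
    rw [← (hev ν).map_eq, Measure.map_map (hmeas ν) (hev ν).measurable]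
    rfl
  have hX := hZ.continuous_comp (g := fun z : Q => ‖z‖ ^ 2) (by fun_prop)
  have hTmeas : ∀ ν, AEMeasurable (fun ω : ℕ → Fin k → ℕ => T ν (ω ν)) R := fun ν =>
    ((Measurable.of_discrete (f := T ν)).comp (hev ν).measurable).aemeasurable
  have hdiff : TendstoInMeasure R ((fun ν (ω : ℕ → Fin k → ℕ) => T ν (ω ν)) - (fun ν =>
      (fun z : Q => ‖z‖ ^ 2) ∘ fun ω : ℕ → Fin k → ℕ =>
        Q.orthogonalProjectionOnto (√(N ν) • normTable μ (N ν) (ω ν)))) atTop 0 := by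
    rw [tendstoInMeasure_iff_norm]
    intro η hη
    rw [ENNReal.tendsto_nhds_zero]
    intro p hp
    obtain ⟨C, hC0, hC⟩ := exists_measure_norm_normTable_le hμ hN0 hN hτ hp
    -- With this constant the error is at most η/2 on the event √N ‖x‖ ≤ C, so it can reach η only
    -- off that event.
    obtain ⟨δ, hδ, hTδ⟩ := hT (η / (2 * C ^ 2)) (by positivity)
    have hlarge : ∀ᶠ ν in atTop, C / δ < √(N ν) :=
      (Real.tendsto_sqrt_atTop.comp hN).eventually_gt_atTop _
    filter_upwards [hlarge] with ν hν
    have hs := Real.sqrt_pos.2 (hN0 ν)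
    set D : Set (Fin k → ℕ) := {n | η ≤ ‖T ν n - ‖Q.orthogonalProjectionOnto
      (√(N ν) • normTable μ (N ν) n)‖ ^ 2‖}
    have h1 : R {ω | η ≤ ‖((fun ν (ω : ℕ → Fin k → ℕ) => T ν (ω ν)) - (fun ν =>
      (fun z : Q => ‖z‖ ^ 2) ∘ fun ω : ℕ → Fin k → ℕ =>
        Q.orthogonalProjectionOnto (√(N ν) • normTable μ (N ν) (ω ν)))) ν ω - (0 : ℕ → (ℕ → Fin k → ℕ) → ℝ) ν ω‖}
        = law ν D := by
      rw [← (hev ν).measure_preimage (Set.to_countable D).measurableSet.nullMeasurableSet]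
      congr 1
      ext ω
      simp [D]
    have h8 : law ν D ≤ p := by
      refine (measure_mono_ae ?_).trans (hC ν)
      filter_upwards [ae_tableLaw_totals (S := S) (N ν • μ) (τ ν)] with n hntot hnD
      refine ⟨hntot, ?_⟩
      by_contra! hle
      have hle' : √(N ν) * ‖normTable μ (N ν) n‖ ≤ C := by
        rwa [norm_smul, Real.norm_of_nonneg hs.le] at hle
      have hsmall : ‖normTable μ (N ν) n‖ < δ := by
        rw [div_lt_iff₀ hδ] at hν
        exact lt_of_mul_lt_mul_left (hle'.trans_lt hν) hs.le
      have h2 := hTδ ν n hntot hsmall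
      have h3 : ‖Q.orthogonalProjectionOnto (√(N ν) • normTable μ (N ν) n)‖ ^ 2
          = N ν * ‖Q.starProjection (normTable μ (N ν) n)‖ ^ 2 := by
        rw [map_smul, norm_smul, mul_pow, Real.norm_of_nonneg hs.le, Real.sq_sqrt (hN0 ν).le,
          Submodule.starProjection_apply, Submodule.coe_norm]
      have h4 : N ν * ‖normTable μ (N ν) n‖ ^ 2 ≤ C ^ 2 := by
        have := pow_le_pow_left₀ (by positivity) hle' 2
        rwa [mul_pow, Real.sq_sqrt (hN0 ν).le] at this
      have h5 : η ≤ |T ν n - N ν * ‖Q.starProjection (normTable μ (N ν) n)‖ ^ 2| := by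
        rw [← h3]
        exact hnD
      have h6 : η / (2 * C ^ 2) * (N ν * ‖normTable μ (N ν) n‖ ^ 2) ≤ η / (2 * C ^ 2) * C ^ 2 := by
        gcongr
      have h7 : η / (2 * C ^ 2) * C ^ 2 = η / 2 := by field_simp
      linarith
    exact h1.le.trans h8
  have hfinal := tendstoInDistribution_of_tendstoInMeasure_sub _ _ hX hdiff hTmeas
  refine ⟨fun ν => (Measurable.of_discrete (f := T ν)).comp_aemeasurable (hn ν).aemeasurable,
    aemeasurable_id, ?_⟩
  -- Convergence in distribution depends only on the laws, so the result returns from the common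
  -- space to the given `Ω ν`.
  have hmapeq : ∀ ν, (P ν).map (fun ω => T ν (n ν ω)) = R.map (fun ω => T ν (ω ν)) := fun ν => by
    have h1 := AEMeasurable.map_map_of_aemeasurable (μ := P ν) (g := T ν) (f := n ν)
      (Measurable.of_discrete.aemeasurable) (hn ν).aemeasurable
    have h2 := Measure.map_map (μ := R) (g := T ν) Measurable.of_discrete (hev ν).measurable
    rw [(hn ν).map_eq] at h1
    rw [(hev ν).map_eq] at h2
    exact h1.symm.trans h2
  convert! hfinal.tendsto using 2
  · exact congrArg Tendsto (funext fun ν => Subtype.ext (hmapeq ν))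
  · refine congrArg 𝓝 (Subtype.ext ?_)
    change (chiSquared _).map id = (stdGaussian Q).map (fun z => ‖z‖ ^ 2)
    rw [Measure.map_id, map_norm_sq_stdGaussian]

end NormalizedTable

end LoglinearLC

namespace LoglinearLC

open Asymptotics Topology

/-! ### Projections onto nested subspaces -/

section Projections

variable {E : Type*} [NormedAddCommGroup E] [InnerProductSpace ℝ E] [FiniteDimensional ℝ E]
  {W W' : Submodule ℝ E}

lemma starProjection_orthogonal_inf (h : W' ≤ W) (x : E) :
    (W'ᗮ ⊓ W).starProjection x = W.starProjection x - W'.starProjection x := by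
  refine Submodule.eq_starProjection_of_mem_orthogonal ⟨?_, ?_⟩ ?_
  · have h1 := W'.sub_starProjection_mem_orthogonal x
    have h2 := Submodule.orthogonal_le h (W.sub_starProjection_mem_orthogonal x)
    have h3 := W'ᗮ.sub_mem h1 h2
    rwa [sub_sub_sub_cancel_left] at h3
  · exact W.sub_mem (W.starProjection_apply_mem _) (h (W'.starProjection_apply_mem _))
  · have h1 := Submodule.orthogonal_le (inf_le_right : W'ᗮ ⊓ W ≤ W)
      (W.sub_starProjection_mem_orthogonal x)
    have h2 : W'.starProjection x ∈ (W'ᗮ ⊓ W)ᗮ :=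
      Submodule.orthogonal_le (inf_le_left : W'ᗮ ⊓ W ≤ W'ᗮ)
        (W'.le_orthogonal_orthogonal (W'.starProjection_apply_mem x))
    have h3 := (W'ᗮ ⊓ W)ᗮ.add_mem h1 h2
    rwa [sub_add] at h3

lemma norm_sub_starProjection_sq_sub (h : W' ≤ W) (x : E) :
    ‖x - W'.starProjection x‖ ^ 2 - ‖x - W.starProjection x‖ ^ 2
      = ‖W.starProjection x - W'.starProjection x‖ ^ 2 := by
  have horth : inner ℝ (x - W.starProjection x) (W.starProjection x - W'.starProjection x) = 0 :=
    (W.mem_orthogonal' _).1 (W.sub_starProjection_mem_orthogonal x) _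
      (W.sub_mem (W.starProjection_apply_mem _) (h (W'.starProjection_apply_mem _)))
  have := norm_add_sq_eq_norm_sq_add_norm_sq_real horth
  rw [sub_add_sub_cancel] at this
  rw [pow_two, this]
  ring

end Projections

/-! ### Normalization removes the dependence on N -/

section Model

variable {k : ℕ} {S : SamplingPlan k}

lemma LMLC.mean_pos (M : LMLC S) (θ : Fin M.t → ℝ) (i : Fin k) : 0 < M.mean θ i := Real.exp_pos _

lemma LMLC.constraintSpace_le (M : LMLC S) (μ : Fin k → ℝ) :
    constraintSpace M.L μ ≤ constraintSpace S.X0 μ := fun y hy => by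
  rw [mem_constraintSpace] at hy ⊢
  refine transpose_mulVec_eq_zero_of_range_le ?_ hy
  rintro _ ⟨v, rfl⟩
  refine ⟨Sum.elim v 0, ?_⟩
  simp [LMLC.L, Matrix.fromCols_mulVec]

variable {M : LMLC S} {μ : Fin k → ℝ} {N : ℕ → ℝ} {τ : ℕ → Fin S.c → ℕ}
  {dstar : ℕ → Fin M.r → ℝ}

lemma LMLC.transpose_mulVec_of_mem_meanSet {s : Fin S.c → ℝ} {d : Fin M.r → ℝ} {m : Fin k → ℝ}
    (hm : m ∈ M.meanSet s d) : M.Lᵀ *ᵥ m = Sum.elim s d := by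
  obtain ⟨θ, hθ, rfl⟩ := hm
  exact hθ

lemma LMLC.totals_of_mem_meanSet {s : Fin S.c → ℝ} {d : Fin M.r → ℝ} {m : Fin k → ℝ}
    (hm : m ∈ M.meanSet s d) : S.totals m = s := by
  have h := LMLC.transpose_mulVec_of_mem_meanSet hm
  ext h'
  have h1 := congrFun h (Sum.inl h')
  rw [Sum.elim_inl] at h1
  rw [← h1]
  rfl

/-- A model containing mean vectors of different sizes but the same shape contains the constant
vectors in the column space of its design matrix. -/
lemma LMLC.exists_mulVec_eq_one (hN0 : ∀ ν, 0 < N ν) (hN : Tendsto N atTop atTop)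
    (hμ : ∀ i, 0 < μ i) (hm : ∀ ν, N ν • μ ∈ M.meanSet (fun h => (τ ν h : ℝ)) (dstar ν)) :
    ∃ θ₁, M.X *ᵥ θ₁ = fun _ => 1 := by
  -- Two mean vectors with different `N`: the difference of their logarithms is a nonzero constant
  -- vector in the column space of `X`.
  obtain ⟨ν, hν⟩ := (hN.eventually_gt_atTop (N 0)).exists
  obtain ⟨θ, -, hθ⟩ := hm ν
  obtain ⟨θ₀, -, hθ₀⟩ := hm 0
  have hlog : ∀ (ν : ℕ) (θ : Fin M.t → ℝ), M.mean θ = N ν • μ → ∀ i,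
      (M.X *ᵥ θ) i = Real.log (N ν) + Real.log (μ i) := fun ν θ h i => by
    have h1 := congrFun h i
    simp only [LMLC.mean, Pi.smul_apply, smul_eq_mul] at h1
    rw [← Real.log_mul (hN0 ν).ne' (hμ i).ne', ← h1, Real.log_exp]
  have hne : Real.log (N ν) - Real.log (N 0) ≠ 0 := by
    have := Real.log_lt_log (hN0 0) hν
    linarith
  refine ⟨(Real.log (N ν) - Real.log (N 0))⁻¹ • (θ - θ₀), ?_⟩
  ext i
  rw [Matrix.mulVec_smul, Matrix.mulVec_sub, Pi.smul_apply, Pi.sub_apply, hlog ν θ hθ,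
    hlog 0 θ₀ hθ₀, add_sub_add_right_eq_sub, smul_eq_mul, inv_mul_cancel₀ hne]

lemma LMLC.mean_add_smul {θ₁ : Fin M.t → ℝ} (h1 : M.X *ᵥ θ₁ = fun _ => 1) {c : ℝ} (hc : 0 < c)
    (θ : Fin M.t → ℝ) : M.mean (θ + Real.log c • θ₁) = c • M.mean θ := by
  ext i
  simp only [LMLC.mean, Matrix.mulVec_add, Matrix.mulVec_smul, h1, Pi.add_apply, Pi.smul_apply,
    smul_eq_mul, mul_one, Real.exp_add, Real.exp_log hc]
  ring

/-- In terms of normalized mean vectors, the model does not vary along the asymptotics. -/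
lemma LMLC.meanSet_eq_smul_fitSet (hN0 : ∀ ν, 0 < N ν) (hN : Tendsto N atTop atTop)
    (hμ : ∀ i, 0 < μ i) (hm : ∀ ν, N ν • μ ∈ M.meanSet (fun h => (τ ν h : ℝ)) (dstar ν))
    (ν : ℕ) (q : Fin k → ℝ) :
    N ν • q ∈ M.meanSet (fun h => (τ ν h : ℝ)) (dstar ν) ↔ q ∈ fitSet M.X M.L μ := by
  obtain ⟨θ₁, hθ₁⟩ := LMLC.exists_mulVec_eq_one hN0 hN hμ hm
  -- The right-hand side is forced to be Lᵀ (N μ), so it scales with `N`.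
  have hL := LMLC.transpose_mulVec_of_mem_meanSet (hm ν)
  constructor
  · rintro ⟨θ, hθ, hθq⟩
    have h1 : M.mean (θ + Real.log (N ν)⁻¹ • θ₁) = q := by
      rw [LMLC.mean_add_smul hθ₁ (inv_pos.2 (hN0 ν)), hθq, inv_smul_smul₀ (hN0 ν).ne']
    refine ⟨⟨_, fun i => (congrFun h1 i).symm⟩, ?_⟩
    have h2 : M.Lᵀ *ᵥ (N ν • q) = M.Lᵀ *ᵥ (N ν • μ) := by
      rw [← hθq, hL]
      exact hθ
    rw [Matrix.mulVec_smul, Matrix.mulVec_smul] at h2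
    exact smul_right_injective _ (hN0 ν).ne' h2
  · rintro ⟨⟨θ, hθ⟩, hq⟩
    have h1 : M.mean (θ + Real.log (N ν) • θ₁) = N ν • q := by
      rw [LMLC.mean_add_smul hθ₁ (hN0 ν)]
      congr 1
      ext i
      exact (hθ i).symm
    refine ⟨_, ?_, h1⟩
    change M.Lᵀ *ᵥ M.mean _ = _
    rw [h1, Matrix.mulVec_smul, hq, ← Matrix.mulVec_smul, hL]

end Model

/-! ### First order behaviour of the estimators -/

section Estimator

variable {k : ℕ} {S : SamplingPlan k}

/-- Tables with the prefixed totals, approaching `μ` after normalization. -/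
noncomputable def tableFilter (S : SamplingPlan k) (μ : Fin k → ℝ) (N : ℕ → ℝ) (τ : ℕ → Fin S.c → ℕ) :
    Filter (ℕ × (Fin k → ℕ)) :=
  comap (fun z => normTable μ (N z.1) z.2) (𝓝 0) ⊓
    𝓟 {z | S.totals (realCounts z.2) = fun h => (τ z.1 h : ℝ)}

variable {M : LMLC S} {μ : Fin k → ℝ} {N : ℕ → ℝ} {τ : ℕ → Fin S.c → ℕ}
  {dstar : ℕ → Fin M.r → ℝ} {φ : ℝ → EReal}

lemma tendsto_normTable :
    Tendsto (fun z : ℕ × (Fin k → ℕ) => normTable μ (N z.1) z.2) (tableFilter S μ N τ) (𝓝 0) :=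
  tendsto_comap.mono_left inf_le_left

lemma tendsto_smul_realCounts (hμ : ∀ i, 0 < μ i) :
    Tendsto (fun z : ℕ × (Fin k → ℕ) => (N z.1)⁻¹ • realCounts z.2) (tableFilter S μ N τ) (𝓝 μ) := by
  have h := ((continuous_chart μ).tendsto 0).comp (tendsto_normTable (S := S) (μ := μ) (N := N) (τ := τ))
  rw [chart_zero] at h
  exact h.congr fun z => chart_chartInv hμ _

lemma eventually_realCounts_pos (hμ : ∀ i, 0 < μ i) (hN0 : ∀ ν, 0 < N ν) :
    ∀ᶠ z in tableFilter S μ N τ, ∀ i, 0 < realCounts z.2 i := by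
  refine eventually_all.2 fun i => ?_
  have h := ((continuous_apply i).tendsto μ).comp
    (tendsto_smul_realCounts (S := S) (N := N) (τ := τ) hμ)
  filter_upwards [h.eventually_const_lt (hμ i)] with z hz
  exact (pos_iff_pos_of_mul_pos hz).1 (inv_pos.2 (hN0 z.1))

lemma IsPhi.phiDiv_eq_mul_realDiv (hφ : IsPhi φ) {c : ℝ} (hc : 0 < c) {p q : Fin k → ℝ}
    (hp : ∀ i, 0 < p i) (hq : ∀ i, 0 < q i) :
    phiDiv φ p q = ((c * realDiv φ (c⁻¹ • p) (c⁻¹ • q) : ℝ) : EReal) := by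
  rw [hφ.phiDiv_eq hp hq, ← realDiv_smul hc.ne', smul_inv_smul₀ hc.ne', smul_inv_smul₀ hc.ne']

/-- The normalized fitted mean vector minimizes the divergence over the normalized model, for
tables close to the normalized true mean vector. -/
lemma eventually_estimator_isMin (hφ : IsPhi φ) (hN0 : ∀ ν, 0 < N ν) (hN : Tendsto N atTop atTop)
    (hμ : ∀ i, 0 < μ i) (hm : ∀ ν, N ν • μ ∈ M.meanSet (fun h => (τ ν h : ℝ)) (dstar ν))
    {est : ℕ → (Fin k → ℕ) → (Fin M.t → ℝ)}
    (hest : ∀ ν, M.IsMinPhiDivEstimator φ (dstar ν) (est ν)) :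
    ∀ᶠ z in tableFilter S μ N τ, (N z.1)⁻¹ • M.mean (est z.1 z.2) ∈ fitSet M.X M.L μ ∧
      ∀ q ∈ fitSet M.X M.L μ,
        realDiv φ ((N z.1)⁻¹ • realCounts z.2) ((N z.1)⁻¹ • M.mean (est z.1 z.2))
          ≤ realDiv φ ((N z.1)⁻¹ • realCounts z.2) q := by
  have hfit := LMLC.meanSet_eq_smul_fitSet hN0 hN hμ hm
  have hex := hφ.exists_minimizer hμ (fun q hq => fitSet_pos hq) ((hfit 0 μ).1 (hm 0))
    (fun K => isCompact_inter_fitSet M.X M.L μ)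
  have hok : ∀ᶠ z in tableFilter S μ N τ,
      S.totals (realCounts z.2) = fun h => (τ z.1 h : ℝ) :=
    mem_inf_of_right (mem_principal_self _)
  filter_upwards [(tendsto_smul_realCounts (S := S) (N := N) (τ := τ) hμ).eventually hex,
    eventually_realCounts_pos (S := S) (τ := τ) hμ hN0, hok] with ⟨ν, n⟩ h1 hpos htot
  simp only at h1 hpos htot ⊢
  obtain ⟨q, hq, hqmin⟩ := h1
  have hNν := hN0 ν
  have hdiv := fun θ => hφ.phiDiv_eq_mul_realDiv hNν hpos (M.mean_pos θ)
  have hmem : ∀ θ ∈ M.paramSpace (fun h => (τ ν h : ℝ)) (dstar ν),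
      (N ν)⁻¹ • M.mean θ ∈ fitSet M.X M.L μ := fun θ hθ =>
    (hfit ν _).1 ⟨θ, hθ, (smul_inv_smul₀ hNν.ne' _).symm⟩
  have hE := hest ν n
  rw [htot] at hE
  obtain ⟨θ, hθ, hθq⟩ := (hfit ν q).2 hq
  obtain ⟨he1, he2⟩ := hE ⟨θ, hθ, fun θ' hθ' => by
    change phiDiv φ _ _ ≤ phiDiv φ _ _
    rw [hdiv θ, hdiv θ', hθq, inv_smul_smul₀ hNν.ne', EReal.coe_le_coe_iff]
    exact mul_le_mul_of_nonneg_left (hqmin _ (hmem θ' hθ')) hNν.le⟩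
  refine ⟨hmem _ he1, fun q' hq' => ?_⟩
  obtain ⟨θ', hθ', hθq'⟩ := (hfit ν q').2 hq'
  have h2 : phiDiv φ (realCounts n) (M.mean (est ν n)) ≤ phiDiv φ (realCounts n) (M.mean θ') :=
    he2 hθ'
  rw [hdiv, hdiv, hθq', inv_smul_smul₀ hNν.ne', EReal.coe_le_coe_iff] at h2
  exact le_of_mul_le_mul_left h2 hNν

/-- The first order expansion of a minimum divergence estimator. -/
theorem estimator_expansion (hφ : IsPhi φ) (hN0 : ∀ ν, 0 < N ν) (hN : Tendsto N atTop atTop)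
    (hμ : ∀ i, 0 < μ i) (hm : ∀ ν, N ν • μ ∈ M.meanSet (fun h => (τ ν h : ℝ)) (dstar ν))
    (hreg : (M.Xᵀ * Matrix.diagonal μ * M.L).rank = S.c + M.r)
    {est : ℕ → (Fin k → ℕ) → (Fin M.t → ℝ)}
    (hest : ∀ ν, M.IsMinPhiDivEstimator φ (dstar ν) (est ν)) :
    (fun z : ℕ × (Fin k → ℕ) => chartInv μ ((N z.1)⁻¹ • M.mean (est z.1 z.2))
      - (tangentSpace M.X M.L μ).starProjection (normTable μ (N z.1) z.2))
      =o[tableFilter S μ N τ] fun z => normTable μ (N z.1) z.2 := by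
  have hμA : μ ∈ fitSet M.X M.L μ :=
    (LMLC.meanSet_eq_smul_fitSet hN0 hN hμ hm 0 μ).1 (hm 0)
  have hmin := eventually_estimator_isMin hφ hN0 hN hμ hm hest
  obtain ⟨g, hgA, hg⟩ := exists_approx_tangentSpace hμ hμA
    (range_eq_top_of_rank (by rw [hreg]; simp))
  -- Consistency: the fitted vector has divergence no larger than that of `μ`, which forces it close
  -- to `μ`.
  have hlim : Tendsto (fun z : ℕ × (Fin k → ℕ) => (N z.1)⁻¹ • M.mean (est z.1 z.2))
      (tableFilter S μ N τ) (𝓝 μ) := by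
    refine tendsto_pi_nhds.2 fun i => Metric.tendsto_nhds.2 fun ε hε => ?_
    filter_upwards [(tendsto_smul_realCounts (S := S) (N := N) (τ := τ) hμ).eventually
      (hφ.close_of_realDiv_small hμ hε), hmin] with z h1 h2
    exact h1 _ (fitSet_pos h2.1) (h2.2 μ hμA) i
  have hy : Tendsto (fun z : ℕ × (Fin k → ℕ) => chartInv μ ((N z.1)⁻¹ • M.mean (est z.1 z.2)))
      (tableFilter S μ N τ) (𝓝 0) := by
    have h1 := ((continuous_chartInv μ).tendsto μ).comp hlim
    rwa [show chartInv μ μ = 0 by ext i; simp [chartInv]] at h1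
  refine minimizer_sub_starProjection_isLittleO
    (G := fun x y => realDiv φ (chart μ x) (chart μ y)) (A := {y | chart μ y ∈ fitSet M.X M.L μ})
    (half_pos hφ.secondDeriv_one_pos) (hφ.realDiv_chart_expansion hμ)
    (by rw [Set.mem_ofPred_eq, chart_zero]; exact hμA)
    (sub_starProjection_tangentSpace_isLittleO hμ hμA) hgA hg tendsto_normTable hy ?_ ?_
  · filter_upwards [hmin] with z hz
    rw [chart_chartInv hμ]
    exact hz.1
  · filter_upwards [hmin] with z hz y hy
    rw [chart_chartInv hμ, normTable, chart_chartInv hμ]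
    exact hz.2 _ hy

end Estimator

/-! ### Second order expansion of the two statistics -/

section Statistics

variable {k : ℕ} {S : SamplingPlan k} {μ : Fin k → ℝ} {N : ℕ → ℝ} {τ : ℕ → Fin S.c → ℕ}

/-- Quantitative form of the second order expansion of a statistic. -/
lemma exists_delta_of_isLittleO (hN0 : ∀ ν, 0 < N ν)
    {Q : Submodule ℝ (EuclideanSpace ℝ (Fin k))} {T : ℕ → (Fin k → ℕ) → ℝ}
    (h : (fun z : ℕ × (Fin k → ℕ) => (N z.1)⁻¹ * T z.1 z.2
      - ‖Q.starProjection (normTable μ (N z.1) z.2)‖ ^ 2) =o[tableFilter S μ N τ]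
        fun z => ‖normTable μ (N z.1) z.2‖ ^ 2) :
    ∀ ε > 0, ∃ δ > 0, ∀ ν n, S.totals (realCounts n) = (fun h => (τ ν h : ℝ)) →
      ‖normTable μ (N ν) n‖ < δ →
      |T ν n - N ν * ‖Q.starProjection (normTable μ (N ν) n)‖ ^ 2|
        ≤ ε * (N ν * ‖normTable μ (N ν) n‖ ^ 2) := by
  intro ε hε
  have h1 := h.def hε
  -- The filter puts no restriction on the index beyond the totals, so `δ` is uniform in `ν`.
  rw [tableFilter, eventually_inf_principal, eventually_comap] at h1
  obtain ⟨δ, hδ, hball⟩ := Metric.eventually_nhds_iff.1 h1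
  refine ⟨δ, hδ, fun ν n htot hn => ?_⟩
  have h2 := hball (by simpa using hn) (ν, n) rfl htot
  simp only [Real.norm_eq_abs, abs_pow, abs_norm] at h2
  have h3 : T ν n - N ν * ‖Q.starProjection (normTable μ (N ν) n)‖ ^ 2
      = N ν * ((N ν)⁻¹ * T ν n - ‖Q.starProjection (normTable μ (N ν) n)‖ ^ 2) := by
    rw [mul_sub, mul_inv_cancel_left₀ (hN0 ν).ne']
  rw [h3, abs_mul, abs_of_pos (hN0 ν)]
  calc _ ≤ N ν * (ε * ‖normTable μ (N ν) n‖ ^ 2) := mul_le_mul_of_nonneg_left h2 (hN0 ν).le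
    _ = _ := by ring

variable {M M' : LMLC S} {φ : ℝ → EReal} {W W' : Submodule ℝ (EuclideanSpace ℝ (Fin k))}
  {est : ℕ → (Fin k → ℕ) → (Fin M.t → ℝ)} {est' : ℕ → (Fin k → ℕ) → (Fin M'.t → ℝ)}

/-- Only the first order expansions of the fitted means enter, and these are free of the divergence
that defined the estimators; hence `φ` here may be a different function. -/
lemma statT_expansion (hφ : IsPhi φ) (hN0 : ∀ ν, 0 < N ν) (hμ : ∀ i, 0 < μ i) (hW : W' ≤ W)
    (h : (fun z : ℕ × (Fin k → ℕ) => chartInv μ ((N z.1)⁻¹ • M.mean (est z.1 z.2))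
      - W.starProjection (normTable μ (N z.1) z.2))
      =o[tableFilter S μ N τ] fun z => normTable μ (N z.1) z.2)
    (h' : (fun z : ℕ × (Fin k → ℕ) => chartInv μ ((N z.1)⁻¹ • M'.mean (est' z.1 z.2))
      - W'.starProjection (normTable μ (N z.1) z.2))
      =o[tableFilter S μ N τ] fun z => normTable μ (N z.1) z.2) :
    (fun z : ℕ × (Fin k → ℕ) => (N z.1)⁻¹ *
        statT φ (M.mean (est z.1 z.2)) (M'.mean (est' z.1 z.2))
      - ‖(W'ᗮ ⊓ W).starProjection (normTable μ (N z.1) z.2)‖ ^ 2) =o[tableFilter S μ N τ]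
        fun z => ‖normTable μ (N z.1) z.2‖ ^ 2 := by
  have hexp := divergence_expansion
    (G := fun x y => realDiv φ (chart μ x) (chart μ y)) (hφ.realDiv_chart_expansion hμ) tendsto_normTable h h'
    (W.starProjection.isBigO_comp _ _) (W'.starProjection.isBigO_comp _ _)
  refine (hexp.const_mul_left (2 / secondDerivOne φ)).congr_left fun z => ?_
  have ha := hφ.secondDeriv_one_pos.ne'
  have hNz := (hN0 z.1).ne'
  rw [chart_chartInv hμ, chart_chartInv hμ, starProjection_orthogonal_inf hW, statT,
    hφ.phiDiv_eq_mul_realDiv (hN0 z.1) (M.mean_pos _) (M'.mean_pos _), EReal.toReal_coe]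
  field_simp

/-- Pythagoras: ‖x - P' x‖² - ‖x - P x‖² = ‖P x - P' x‖². Near `μ` all counts are positive, so both
divergences are real. -/
lemma statS_expansion (hφ : IsPhi φ) (hN0 : ∀ ν, 0 < N ν) (hμ : ∀ i, 0 < μ i) (hW : W' ≤ W)
    (h : (fun z : ℕ × (Fin k → ℕ) => chartInv μ ((N z.1)⁻¹ • M.mean (est z.1 z.2))
      - W.starProjection (normTable μ (N z.1) z.2))
      =o[tableFilter S μ N τ] fun z => normTable μ (N z.1) z.2)
    (h' : (fun z : ℕ × (Fin k → ℕ) => chartInv μ ((N z.1)⁻¹ • M'.mean (est' z.1 z.2))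
      - W'.starProjection (normTable μ (N z.1) z.2))
      =o[tableFilter S μ N τ] fun z => normTable μ (N z.1) z.2) :
    (fun z : ℕ × (Fin k → ℕ) => (N z.1)⁻¹ *
        statS φ (realCounts z.2) (M.mean (est z.1 z.2)) (M'.mean (est' z.1 z.2))
      - ‖(W'ᗮ ⊓ W).starProjection (normTable μ (N z.1) z.2)‖ ^ 2) =o[tableFilter S μ N τ]
        fun z => ‖normTable μ (N z.1) z.2‖ ^ 2 := by
  have hx0 : (fun z : ℕ × (Fin k → ℕ) => normTable μ (N z.1) z.2 - normTable μ (N z.1) z.2)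
      =o[tableFilter S μ N τ] fun z => normTable μ (N z.1) z.2 := by
    simp only [sub_self]
    exact isLittleO_zero _ _
  have hexp := divergence_expansion
    (G := fun x y => realDiv φ (chart μ x) (chart μ y)) (hφ.realDiv_chart_expansion hμ) tendsto_normTable hx0 h
    (isBigO_refl _ _) (W.starProjection.isBigO_comp _ _)
  have hexp' := divergence_expansion
    (G := fun x y => realDiv φ (chart μ x) (chart μ y)) (hφ.realDiv_chart_expansion hμ) tendsto_normTable hx0 h'
    (isBigO_refl _ _) (W'.starProjection.isBigO_comp _ _)
  refine ((hexp'.sub hexp).const_mul_left (2 / secondDerivOne φ)).congr' ?_ .rfl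
  filter_upwards [eventually_realCounts_pos (S := S) (τ := τ) hμ hN0] with z hz
  have ha := hφ.secondDeriv_one_pos.ne'
  have hNz := (hN0 z.1).ne'
  rw [chart_chartInv hμ, chart_chartInv hμ, starProjection_orthogonal_inf hW,
    ← norm_sub_starProjection_sq_sub hW, statS,
    hφ.phiDiv_eq_mul_realDiv (hN0 z.1) hz (M.mean_pos _), EReal.toReal_coe,
    hφ.phiDiv_eq_mul_realDiv (hN0 z.1) hz (M'.mean_pos _), EReal.toReal_coe,
    show chart μ (normTable μ (N z.1) z.2) = (N z.1)⁻¹ • realCounts z.2 from chart_chartInv hμ _]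
  field_simp
  ring

end Statistics

end LoglinearLC

/-! ### Assembly -/

theorem theorem9 {k : ℕ} (S : LoglinearLC.SamplingPlan k)
    -- the nested sequence `M 1, …, M B`; the index `ν` runs along the asymptotics, `τ ν` are the
    -- prefixed totals and `dstar b ν` is the right-hand side of the additional constraints
    (B : ℕ) (M : ℕ → LoglinearLC.LMLC S)
    (τ : ℕ → Fin S.c → ℕ) (dstar : ∀ b : ℕ, ℕ → Fin (M b).r → ℝ)
    (hnested : ∀ b : ℕ, 1 ≤ b → b < B → ∀ ν : ℕ,
      LoglinearLC.LMLC.Nested (M (b + 1)) (M b) (fun h => (τ ν h : ℝ))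
        (dstar (b + 1) ν) (dstar b ν))
    (φ₁ φ₂ : ℝ → EReal) (hφ₁ : LoglinearLC.IsPhi φ₁) (hφ₂ : LoglinearLC.IsPhi φ₂)
    (b : ℕ) (hb : 1 ≤ b) (hbB : b < B)
    -- the null hypothesis: the true mean vectors belong to `M (b + 1)`
    (m : ℕ → Fin k → ℝ)
    (hnull : ∀ ν : ℕ, m ν ∈ (M (b + 1)).meanSet (fun h => (τ ν h : ℝ)) (dstar (b + 1) ν))
    -- `N = ∑ i, m i` tends to infinity and the normalized mean vector `m / N` remains fixed
    (mstar : Fin k → ℝ)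
    (hN : Filter.Tendsto (fun ν => ∑ i, m ν i) Filter.atTop Filter.atTop)
    (hmstar : ∀ (ν : ℕ) (i : Fin k), m ν i / ∑ j, m ν j = mstar i)
    -- regularity of the null model: `B(θ₀) = Xᵀ diag(m*) L` has full column rank
    (hreg : ((M (b + 1)).Xᵀ * Matrix.diagonal mstar * (M (b + 1)).L).rank
      = S.c + (M (b + 1)).r)
    -- the data
    {Ω : ℕ → Type*} [∀ ν, MeasurableSpace (Ω ν)]
    (P : ∀ ν, MeasureTheory.Measure (Ω ν)) [∀ ν, MeasureTheory.IsProbabilityMeasure (P ν)]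
    (n : ∀ ν, Ω ν → Fin k → ℕ)
    (hn : ∀ ν, ProbabilityTheory.HasLaw (n ν) (S.tableLaw (m ν) (τ ν)) (P ν))
    -- the minimum `φ₂`-divergence estimators in the models
    (est : ∀ b' : ℕ, ℕ → (Fin k → ℕ) → (Fin (M b').t → ℝ))
    (hest : ∀ b' : ℕ, 1 ≤ b' → b' ≤ B → ∀ ν : ℕ,
      (M b').IsMinPhiDivEstimator φ₂ (dstar b' ν) (est b' ν)) :
    MeasureTheory.TendstoInDistribution
      (fun ν ω => LoglinearLC.statT φ₁
        ((M b).mean (est b ν (n ν ω))) ((M (b + 1)).mean (est (b + 1) ν (n ν ω))))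
      Filter.atTop id P
      (LoglinearLC.chiSquared
        (((M b).t : ℤ) - (M (b + 1)).t - (M b).r + (M (b + 1)).r).toNat) ∧
    MeasureTheory.TendstoInDistribution
      (fun ν ω => LoglinearLC.statS φ₂ (LoglinearLC.realCounts (n ν ω))
        ((M b).mean (est b ν (n ν ω))) ((M (b + 1)).mean (est (b + 1) ν (n ν ω))))
      Filter.atTop id P
      (LoglinearLC.chiSquared
        (((M b).t : ℤ) - (M (b + 1)).t - (M b).r + (M (b + 1)).r).toNat) := by
  have hpos : ∀ ν i, 0 < m ν i := fun ν i => by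
    obtain ⟨θ, -, hθ⟩ := hnull ν
    rw [← hθ]
    exact Real.exp_pos _
  -- Without cells the total would be 0 and could not tend to infinity.
  have hne : Nonempty (Fin k) := by
    by_contra hk
    rw [not_nonempty_iff] at hk
    obtain ⟨ν, hν⟩ := (hN.eventually_gt_atTop 0).exists
    simp at hν
  have hN0 : ∀ ν, 0 < ∑ i, m ν i := fun ν =>
    Finset.sum_pos (fun i _ => hpos ν i) Finset.univ_nonempty
  have hμ : ∀ i, 0 < mstar i := fun i => by
    rw [← hmstar 0 i]
    exact div_pos (hpos 0 i) (hN0 0)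
  obtain ⟨N, hNdef⟩ : ∃ N : ℕ → ℝ, N = fun ν => ∑ i, m ν i := ⟨_, rfl⟩
  have hm : ∀ ν, m ν = N ν • mstar := fun ν => by
    ext i
    rw [hNdef, Pi.smul_apply, smul_eq_mul, ← hmstar ν i, mul_div_cancel₀ _ (hN0 ν).ne']
  rw [← hNdef] at hN
  have hN0' : ∀ ν, 0 < N ν := fun ν => by
    rw [hNdef]
    exact hN0 ν
  have hnull' : ∀ ν, N ν • mstar ∈
      (M (b + 1)).meanSet (fun h => (τ ν h : ℝ)) (dstar (b + 1) ν) := fun ν => hm ν ▸ hnull ν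
  have hnest := hnested b hb hbB
  have hlarge : ∀ ν, N ν • mstar ∈ (M b).meanSet (fun h => (τ ν h : ℝ)) (dstar b ν) := fun ν =>
    (hnest ν).meanSet_subset (hnull' ν)
  have hrank : (M b).L.rank = S.c + (M b).r := (M b).rank_L
  have hreg' : ((M b).Xᵀ * Matrix.diagonal mstar * (M b).L).rank = S.c + (M b).r := by
    have h := LoglinearLC.rank_eq_card_of_nested (hnest 0).range_X (hnest 0).range_L
      (by simpa using hrank) (by simpa using hreg)
    simpa using h
  have hτ : ∀ ν, S.totals (N ν • mstar) = fun h => (τ ν h : ℝ) := fun ν =>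
    LoglinearLC.LMLC.totals_of_mem_meanSet (hnull' ν)
  have hlaw : ∀ ν, HasLaw (n ν) (S.tableLaw (N ν • mstar) (τ ν)) (P ν) := fun ν => hm ν ▸ hn ν
  have hexp := LoglinearLC.estimator_expansion hφ₂ hN0' hN hμ hlarge hreg' (hest b hb hbB.le)
  have hexp' := LoglinearLC.estimator_expansion hφ₂ hN0' hN hμ hnull' hreg
    (hest (b + 1) (Nat.le_add_left 1 b) hbB)
  have hW := LoglinearLC.tangentSpace_le_of_nested (μ := mstar) (hnest 0).range_X (hnest 0).range_L
  -- The tangent spaces have dimensions t - (c + r), and the smaller one is contained in the larger;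
  -- so the integer is nonnegative and `toNat` loses nothing.
  have hdim : (((M b).t : ℤ) - (M (b + 1)).t - (M b).r + (M (b + 1)).r).toNat
      = Module.finrank ℝ ((LoglinearLC.tangentSpace (M (b + 1)).X (M (b + 1)).L mstar)ᗮ ⊓
        LoglinearLC.tangentSpace (M b).X (M b).L mstar : Submodule ℝ _) := by
    have h1 := LoglinearLC.finrank_tangentSpace (L := (M b).L) hμ (M b).rank_X
    have h2 := LoglinearLC.finrank_tangentSpace (L := (M (b + 1)).L) hμ (M (b + 1)).rank_X
    rw [← LoglinearLC.transpose_product, Matrix.rank_transpose] at h1 h2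
    have h3 := Submodule.finrank_add_inf_finrank_orthogonal hW
    omega
  have hQ : (LoglinearLC.tangentSpace (M (b + 1)).X (M (b + 1)).L mstar)ᗮ ⊓
      LoglinearLC.tangentSpace (M b).X (M b).L mstar ≤
        LoglinearLC.constraintSpace S.X0 mstar :=
    inf_le_right.trans (inf_le_right.trans ((M b).constraintSpace_le mstar))
  rw [hdim]
  exact ⟨LoglinearLC.tendstoInDistribution_chiSquared
      (T := fun ν x => LoglinearLC.statT φ₁ ((M b).mean (est b ν x))
        ((M (b + 1)).mean (est (b + 1) ν x))) hμ hN0' hN hτ hQ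
      (LoglinearLC.exists_delta_of_isLittleO hN0'
        (LoglinearLC.statT_expansion hφ₁ hN0' hμ hW hexp hexp')) P n hlaw,
    LoglinearLC.tendstoInDistribution_chiSquared
      (T := fun ν x => LoglinearLC.statS φ₂ (LoglinearLC.realCounts x) ((M b).mean (est b ν x))
        ((M (b + 1)).mean (est (b + 1) ν x))) hμ hN0' hN hτ hQ
      (LoglinearLC.exists_delta_of_isLittleO hN0'
        (LoglinearLC.statS_expansion hφ₂ hN0' hμ hW hexp hexp')) P n hlaw⟩
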